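/- Let $f:[-1,1]\to\mathbb{R}$. For a finite collection of nonoverlapping closed subintervals $I_i=[u_i,v_i]$ of $[-1,1]$ write $f(I_i)=f(v_i)-f(u_i)$. We say that $f\in HBV$ if $\sup\sum_i |f(I_i)|/i<\infty$, and that $f\in V_2$ if $\sup\sum_i|f(I_i)|^2<\infty$, the suprema being over all finite collections $I_1,\dots,I_N$ (in any order) of nonoverlapping subintervals of $[-1,1]$. Let $w(t)=(1-t)^{-1/2}(1+t)^{-1/2}$ and let $P_0=\sqrt{1/\pi}\,T_0$, $P_k=\sqrt{2/\pi}\,T_k$ $(k\ge 1)$ be the Chebyshev polynomials normalized to be orthonormal on $[-1,1]$ with respect to $w$. Put $a_k(f)=\int_{-1}^1 f(t)P_k(t)w(t)\,dt$, and let $$R_n^{(-1/2,-1/2)}(f;y)=\sum_{k=n}^{\infty}a_k(f)P_k(y)=\lim_{N\to\infty}\sum_{k=n}^{N-1}a_k(f)P_k(y)$$ be the $n$-th order tail of the Fourier–Chebyshev series of $f$. (a) If $f\in HBV$ has finitely many discontinuities in $[-1,1]$, then the integrals defining the $a_k(f)$ exist, the tails $R_n^{(-1/2,-1/2)}(f;y)$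 converge for all $n\ge 0$ and $y\in(-1,1)$, and for each $x\in(-1,1)$ the tails are integrable on $[-1,x]$, the one-sided limits $f(x\pm0)$ exist, and $$\lim_{n\to\infty} n\int_{-1}^{x}R_n^{(-1/2,-1/2)}(f;y)\,dy=-\frac{(1-x^2)^{1/2}}{\pi}\bigl(f(x+0)-f(x-0)\bigr).$$ (b) If $f\in V_2$, then the same conclusions hold with no restriction on the number of discontinuities. -/

import Mathlib

open MeasureTheory Filter Topology Set

/-- `[u i, v i]`, `i : Fin N`, is a finite collection, listed in an arbitrary order, of
nonoverlapping nondegenerate closed subintervals of `[a, b]`. -/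
def IsNonoverlapping (a b : ℝ) {N : ℕ} (u v : Fin N → ℝ) : Prop :=
  (∀ i, a ≤ u i ∧ u i < v i ∧ v i ≤ b) ∧
    ∀ i j, i ≠ j → Disjoint (Ioo (u i) (v i)) (Ioo (u j) (v j))

/-- `f` is of bounded `Λ`-variation on `[a, b]`, `Λ = (lam 1, lam 2, …)`: the sums
`∑ |f(I_i)| / lam i`, with `f([u, v]) = f v - f u`, are bounded over all finite collections
`I_1, …, I_N` of nonoverlapping subintervals (`i : Fin N` stands for the index `i + 1`). -/
def LambdaBV (lam : ℕ → ℝ) (a b : ℝ) (f : ℝ → ℝ) : Prop :=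
  BddAbove {s : ℝ | ∃ (N : ℕ) (u v : Fin N → ℝ), IsNonoverlapping a b u v ∧
    s = ∑ i : Fin N, |f (v i) - f (u i)| / lam ((i : ℕ) + 1)}

/-- Harmonic bounded variation on `[a, b]`: `Λ = (1, 2, 3, …)`. -/
def HBV (a b : ℝ) (f : ℝ → ℝ) : Prop :=
  LambdaBV (fun k => (k : ℝ)) a b f

/-- Wiener's class `V_p` on `[a, b]`: the sums `∑ |f(I_i)| ^ p` are bounded over all finite
collections of nonoverlapping subintervals. -/
def WienerV (p : ℝ) (a b : ℝ) (f : ℝ → ℝ) : Prop :=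
  BddAbove {s : ℝ | ∃ (N : ℕ) (u v : Fin N → ℝ), IsNonoverlapping a b u v ∧
    s = ∑ i : Fin N, |f (v i) - f (u i)| ^ p}

/-- The set of points of `[-1, 1]` at which `f`, as a function on `[-1, 1]`, is discontinuous. -/
def discontinuities (f : ℝ → ℝ) : Set ℝ :=
  {t | t ∈ Icc (-1 : ℝ) 1 ∧ ¬ ContinuousWithinAt f (Icc (-1) 1) t}

noncomputable section

/-- The Jacobi weight with exponents `(-1/2, -1/2)`. -/
def chebyshevWeight (t : ℝ) : ℝ :=
  (1 - t) ^ (-(1 / 2) : ℝ) * (1 + t) ^ (-(1 / 2) : ℝ)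

/-- The orthonormal Chebyshev polynomials: `P_0 = T_0 / √π` and `P_k = √(2/π) T_k`, `k ≥ 1`. -/
def chebyshevP (k : ℕ) : Polynomial ℝ :=
  Polynomial.C (if k = 0 then √(1 / Real.pi) else √(2 / Real.pi)) *
    Polynomial.Chebyshev.T ℝ (k : ℤ)

/-- The `k`-th Fourier–Chebyshev coefficient of `f`. -/
def chebyshevCoeff (f : ℝ → ℝ) (k : ℕ) : ℝ :=
  ∫ t in (-1 : ℝ)..1, f t * (chebyshevP k).eval t * chebyshevWeight t

/-- The finite section `∑_{k=n}^{N-1} a_k(f) P_k(y)` of the Fourier–Chebyshev series. -/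
def chebyshevSection (f : ℝ → ℝ) (n N : ℕ) (y : ℝ) : ℝ :=
  ∑ k ∈ Finset.Ico n N, chebyshevCoeff f k * (chebyshevP k).eval y

/-- The `n`-th order tail `R_n(f; y) = ∑_{k=n}^∞ a_k(f) P_k(y)` of the Fourier–Chebyshev series,
the sum being the limit of the partial sums (the convergence need not be absolute). -/
def chebyshevTail (f : ℝ → ℝ) (n : ℕ) (y : ℝ) : ℝ :=
  limUnder atTop (fun N : ℕ => chebyshevSection f n N y)

end

theorem chebyshevWeight_eq {t : ℝ} (ht : t ∈ Icc (-1 : ℝ) 1) :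
    chebyshevWeight t = √(1 - t ^ 2)⁻¹ := by
  have h1 : 0 ≤ 1 - t := by linarith [ht.2]
  have h2 : 0 ≤ 1 + t := by linarith [ht.1]
  rw [chebyshevWeight, ← Real.mul_rpow h1 h2, show (1 - t) * (1 + t) = 1 - t ^ 2 by ring,
    Real.rpow_neg (by nlinarith), ← Real.sqrt_eq_rpow, Real.sqrt_inv]

/-- `chebyshevP k` has degree `k` and positive leading coefficient. -/
theorem chebyshevP_natDegree_leadingCoeff (k : ℕ) :
    (chebyshevP k).natDegree = k ∧ 0 < (chebyshevP k).leadingCoeff := by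
  have hc : 0 < (if k = 0 then √(1 / Real.pi) else √(2 / Real.pi)) := by
    have := Real.pi_pos
    split_ifs <;> positivity
  constructor
  · rw [chebyshevP, Polynomial.natDegree_C_mul hc.ne', Polynomial.Chebyshev.natDegree_T]
    simp
  · rw [chebyshevP, Polynomial.leadingCoeff_mul, Polynomial.leadingCoeff_C,
      Polynomial.Chebyshev.leadingCoeff_T]
    positivity

/-- The polynomials `chebyshevP k` are orthonormal on `[-1, 1]` for `chebyshevWeight`. -/
theorem chebyshevP_orthonormal (k m : ℕ) :
    ∫ t in (-1 : ℝ)..1, (chebyshevP k).eval t * (chebyshevP m).eval t * chebyshevWeight t =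
      if k = m then 1 else 0 := by
  have hpi := Real.pi_pos
  have key : ∫ t in (-1 : ℝ)..1,
      (chebyshevP k).eval t * (chebyshevP m).eval t * chebyshevWeight t =
      (if k = 0 then √(1 / Real.pi) else √(2 / Real.pi)) *
      (if m = 0 then √(1 / Real.pi) else √(2 / Real.pi)) *
      ∫ t, (Polynomial.Chebyshev.T ℝ (k : ℤ)).eval t * (Polynomial.Chebyshev.T ℝ (m : ℤ)).eval t
        ∂Polynomial.Chebyshev.measureT := by
    rw [Polynomial.Chebyshev.integral_measureT, ← intervalIntegral.integral_const_mul]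
    refine intervalIntegral.integral_congr fun t ht => ?_
    rw [uIcc_of_le (by norm_num)] at ht
    simp only [chebyshevWeight_eq ht, chebyshevP, Polynomial.eval_mul, Polynomial.eval_C]
    ring
  rw [key]
  by_cases h : k = m
  · subst h
    by_cases h0 : k = 0
    · subst h0
      simp only [Nat.cast_zero, if_true]
      rw [Polynomial.Chebyshev.integral_eval_T_real_mul_self_measureT_zero,
        Real.mul_self_sqrt (by positivity)]
      field_simp
    · simp only [if_neg h0, if_true]
      rw [Polynomial.Chebyshev.integral_T_real_mul_self_measureT_of_ne_zero h0,
        Real.mul_self_sqrt (by positivity)]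
      field_simp
  · rw [Polynomial.Chebyshev.integral_eval_T_real_mul_eval_T_real_measureT_of_ne h, if_neg h,
      mul_zero]

/-! Everything follows from bounded harmonic variation, which `WienerV.hbv` supplies in the case of
$V_2$. With $y=\cos\theta$ the Fourier–Chebyshev series of $f$ becomes the cosine series of the even
periodic function $\varphi(\theta)=f(\cos\theta)$, again of bounded harmonic variation, and its
partial sums are convolutions with the Dirichlet kernel.

The analytic core is `IsHarmonicKernel.abs_integral_le`. If $(0,\delta]$ is cut at scale $1/n$, the
kernel has size $O(n/k)$ on the $k$-th piece and its primitive has size $O(1/k)$ there. These are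
exactly the weights of harmonic variation, so the integral of $F$ against the kernel is controlled
by the supremum and the harmonic variation of $F$. Both become small near $0$ once the limit $F(0+)$
is subtracted (`exists_small`), and away from $0$ the Riemann–Lebesgue lemma applies. For the
Dirichlet kernel this gives convergence and uniform boundedness of the partial sums, hence termwise
integration of the tails.

Write $c_k=\int_0^\pi\varphi(t)\cos kt\,dt$ and $x=\cos\theta$. Integrating $P_k$ over $[-1,x]$
produces $-\sin\theta\sin(k\theta)/k+O(k^{-2})$ up to normalization. By the summation lemma
`tendsto_mul_tail_of_cesaro` it suffices to find the limit of the means $\frac1n\sum_{k<n}k\,c_k\sin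
k\theta$. This is Fejér's determination of the jump: the kernel is the differentiated Dirichlet
kernel divided by $n$, which is odd and has mass tending to $1$ on $(0,\pi)$. It is again a harmonic
kernel, so the means tend to $(f(x+0)-f(x-0))/2$. -/

/-! ### Functions of bounded harmonic variation -/

/-- The harmonic variation of `F` on `S` is at most `C`: the sums `∑ |F(I_i)| / (i + 1)` over
finite families of nonoverlapping intervals with endpoints in `S`, indexed by distinct natural
numbers `i`, are bounded by `C`. -/
def HarmonicVarLE (F : ℝ → ℝ) (S : Set ℝ) (C : ℝ) : Prop :=
  ∀ (s : Finset ℕ) (u v : ℕ → ℝ), (∀ i ∈ s, u i ≤ v i ∧ u i ∈ S ∧ v i ∈ S) →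
    (∀ i ∈ s, ∀ j ∈ s, i ≠ j → v i ≤ u j ∨ v j ≤ u i) →
    ∑ i ∈ s, |F (v i) - F (u i)| / ((i : ℝ) + 1) ≤ C

namespace HarmonicVarLE

theorem nonneg {F : ℝ → ℝ} {S : Set ℝ} {C : ℝ} (h : HarmonicVarLE F S C) : 0 ≤ C := by
  simpa using h ∅ 0 0 (by simp) (by simp)

theorem mono {F : ℝ → ℝ} {S T : Set ℝ} {C : ℝ} (h : HarmonicVarLE F S C) (hT : T ⊆ S) :
    HarmonicVarLE F T C := fun s u v h1 h2 =>
  h s u v (fun i hi => ⟨(h1 i hi).1, hT (h1 i hi).2.1, hT (h1 i hi).2.2⟩) h2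

theorem abs_sub_le {F : ℝ → ℝ} {S : Set ℝ} {C : ℝ} (h : HarmonicVarLE F S C) {x y : ℝ}
    (hx : x ∈ S) (hy : y ∈ S) : |F x - F y| ≤ C := by
  wlog hxy : y ≤ x generalizing x y
  · rw [abs_sub_comm]; exact this hy hx (le_of_not_ge hxy)
  have := h {0} (fun _ => y) (fun _ => x) (by simp [hx, hy, hxy]) (by simp)
  simpa using this

theorem comp_monotoneOn {F g : ℝ → ℝ} {S T : Set ℝ} {C : ℝ} (h : HarmonicVarLE F S C)
    (hg : MonotoneOn g T) (hT : MapsTo g T S) : HarmonicVarLE (fun t => F (g t)) T C := by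
  intro s u v h1 h2
  refine h s (fun i => g (u i)) (fun i => g (v i)) (fun i hi => ?_) (fun i hi j hj hij => ?_)
  · exact ⟨hg (h1 i hi).2.1 (h1 i hi).2.2 (h1 i hi).1, hT (h1 i hi).2.1, hT (h1 i hi).2.2⟩
  · exact (h2 i hi j hj hij).imp (fun h => hg (h1 i hi).2.2 (h1 j hj).2.1 h)
      (fun h => hg (h1 j hj).2.2 (h1 i hi).2.1 h)

theorem comp_antitoneOn {F g : ℝ → ℝ} {S T : Set ℝ} {C : ℝ} (h : HarmonicVarLE F S C)
    (hg : AntitoneOn g T) (hT : MapsTo g T S) : HarmonicVarLE (fun t => F (g t)) T C := by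
  intro s u v h1 h2
  simp_rw [abs_sub_comm (F (g (v _)))]
  refine h s (fun i => g (v i)) (fun i => g (u i)) (fun i hi => ?_) (fun i hi j hj hij => ?_)
  · exact ⟨hg (h1 i hi).2.1 (h1 i hi).2.2 (h1 i hi).1, hT (h1 i hi).2.2, hT (h1 i hi).2.1⟩
  · exact (h2 i hi j hj hij).symm.imp (fun h => hg (h1 j hj).2.2 (h1 i hi).2.1 h)
      (fun h => hg (h1 i hi).2.2 (h1 j hj).2.1 h)

theorem sub_const {F : ℝ → ℝ} {S : Set ℝ} {C : ℝ} (h : HarmonicVarLE F S C) (c : ℝ) :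
    HarmonicVarLE (fun t => F t - c) S C := by
  intro s u v h1 h2
  simpa using h s u v h1 h2

/-- An interval straddling `b` is cut by clamping its endpoints with `min · b` and `max · b`.
Clamping is monotone, so it keeps the family nonoverlapping and leaves the indices unchanged. -/
theorem union {F : ℝ → ℝ} {a b c C D : ℝ} (h : HarmonicVarLE F (Icc a b) C)
    (h' : HarmonicVarLE F (Icc b c) D) : HarmonicVarLE F (Icc a c) (C + D) := by
  intro s u v h1 h2
  by_cases hs : s.Nonempty; swap
  · rw [Finset.not_nonempty_iff_eq_empty] at hs
    subst hs
    simpa using add_nonneg h.nonneg h'.nonneg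
  by_cases hab : b < a
  · have : ∑ i ∈ s, |F (v i) - F (u i)| / ((i : ℝ) + 1) ≤ D := by
      refine h'.mono (Icc_subset_Icc_left hab.le) s u v h1 h2
    linarith [h.nonneg]
  by_cases hbc : c < b
  · have : ∑ i ∈ s, |F (v i) - F (u i)| / ((i : ℝ) + 1) ≤ C := by
      refine h.mono (Icc_subset_Icc_right hbc.le) s u v h1 h2
    linarith [h'.nonneg]
  push Not at hab hbc
  have e1 := h s (fun i => min (u i) b) (fun i => min (v i) b) (fun i hi => by
      obtain ⟨h3, h4, h5⟩ := h1 i hi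
      exact ⟨min_le_min_right _ h3, ⟨le_min h4.1 hab, min_le_right _ _⟩,
        ⟨le_min h5.1 hab, min_le_right _ _⟩⟩)
    (fun i hi j hj hij => (h2 i hi j hj hij).imp (fun h => min_le_min_right _ h)
      (fun h => min_le_min_right _ h))
  have e2 := h' s (fun i => max (u i) b) (fun i => max (v i) b) (fun i hi => by
      obtain ⟨h3, h4, h5⟩ := h1 i hi
      exact ⟨max_le_max_right _ h3, ⟨le_max_right _ _, max_le h4.2 hbc⟩,
        ⟨le_max_right _ _, max_le h5.2 hbc⟩⟩)
    (fun i hi j hj hij => (h2 i hi j hj hij).imp (fun h => max_le_max_right _ h)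
      (fun h => max_le_max_right _ h))
  refine le_trans ?_ (add_le_add e1 e2)
  rw [← Finset.sum_add_distrib]
  refine Finset.sum_le_sum fun i _ => ?_
  rw [← add_div]
  gcongr
  have key : ∀ t, F t = F (min t b) + F (max t b) - F b := by
    intro t
    rcases le_total t b with ht | ht <;> simp [ht]
  rw [key (v i), key (u i)]
  refine le_trans (le_of_eq ?_) (abs_add_le _ _)
  congr 1
  ring

/-- Functions of bounded harmonic variation have Cauchy right limits. -/
theorem exists_oscillation_lt {F : ℝ → ℝ} {x b C : ℝ} (h : HarmonicVarLE F (Ioc x b) C)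
    (hb : x < b) {ε : ℝ} (hε : 0 < ε) :
    ∃ δ > x, δ ≤ b ∧ ∀ u ∈ Ioo x δ, ∀ v ∈ Ioo x δ, |F u - F v| < ε := by
  by_contra! hcon
  have H : ∀ d : Ioc x b, ∃ p : Ioc x b × Ioc x b, (p.1 : ℝ) ≤ p.2 ∧ (p.2 : ℝ) < d ∧
      ε ≤ |F p.2 - F p.1| := by
    intro d
    obtain ⟨u, hu, v, hv, huv⟩ := hcon d d.2.1 d.2.2
    have hu' : u ∈ Ioc x b := ⟨hu.1, hu.2.le.trans d.2.2⟩
    have hv' : v ∈ Ioc x b := ⟨hv.1, hv.2.le.trans d.2.2⟩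
    rcases le_total u v with h | h
    · exact ⟨(⟨u, hu'⟩, ⟨v, hv'⟩), h, hv.2, by rwa [abs_sub_comm]⟩
    · exact ⟨(⟨v, hv'⟩, ⟨u, hu'⟩), h, hu.2, huv⟩
  choose p hp1 hp2 hp3 using H
  -- Restarting below the left endpoint of the previous pair makes the intervals disjoint. Each has
  -- increment at least `ε`, so divergence of the harmonic series contradicts the bound `C`.
  let d : ℕ → Ioc x b := fun n => Nat.rec ⟨b, hb, le_rfl⟩ (fun _ d => (p d).1) n
  have hd : ∀ n, d (n + 1) = (p (d n)).1 := fun n => rfl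
  have hanti : Antitone d := antitone_nat_of_succ_le fun n => by
    rw [hd]
    exact (hp1 _).trans (hp2 _).le
  have key : ∀ N, ε * ∑ i ∈ Finset.range N, 1 / ((i : ℝ) + 1) ≤ C := by
    intro N
    refine le_trans ?_ (h (Finset.range N) (fun i => (p (d i)).1) (fun i => (p (d i)).2)
      (fun i _ => ⟨hp1 _, Subtype.property _, Subtype.property _⟩) ?_)
    · rw [Finset.mul_sum]
      refine Finset.sum_le_sum fun i _ => ?_
      rw [mul_one_div]
      gcongr
      exact hp3 _
    · have : ∀ i j, i < j → ((p (d j)).2 : ℝ) ≤ (p (d i)).1 := fun i j hij => by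
        rw [← hd]
        exact (hp2 _).le.trans (hanti (Nat.succ_le_of_lt hij))
      intro i _ j _ hij
      rcases lt_or_gt_of_ne hij with h | h
      · exact Or.inr (this i j h)
      · exact Or.inl (this j i h)
  have := Real.tendsto_sum_range_one_div_nat_succ_atTop.const_mul_atTop hε
  obtain ⟨N, hN⟩ := (this.eventually_gt_atTop C).exists
  exact absurd (key N) (not_le.2 hN)

theorem exists_tendsto_right {F : ℝ → ℝ} {x b C : ℝ} (h : HarmonicVarLE F (Ioc x b) C)
    (hb : x < b) : ∃ l, Tendsto F (𝓝[>] x) (𝓝 l) := by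
  have : Cauchy (map F (𝓝[>] x)) := by
    rw [Metric.cauchy_iff]
    refine ⟨inferInstance, fun ε hε => ?_⟩
    obtain ⟨δ, hδ, _, h2⟩ := h.exists_oscillation_lt hb hε
    refine ⟨F '' Ioo x δ, image_mem_map (Ioo_mem_nhdsGT hδ), ?_⟩
    rintro _ ⟨u, hu, rfl⟩ _ ⟨v, hv, rfl⟩
    exact h2 u hu v hv
  obtain ⟨l, hl⟩ := cauchy_iff_exists_le_nhds.1 this
  exact ⟨l, hl⟩

theorem exists_tendsto_left {F : ℝ → ℝ} {x a C : ℝ} (h : HarmonicVarLE F (Ico a x) C)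
    (ha : a < x) : ∃ l, Tendsto F (𝓝[<] x) (𝓝 l) := by
  have h' : HarmonicVarLE (fun t => F (-t)) (Ioc (-x) (-a)) C :=
    h.comp_antitoneOn (fun s _ t _ hst => neg_le_neg hst)
      (fun t ht => ⟨by linarith [ht.2], by linarith [ht.1]⟩)
  obtain ⟨l, hl⟩ := h'.exists_tendsto_right (by linarith)
  refine ⟨l, ?_⟩
  have := hl.comp (tendsto_neg_nhdsLT (a := x))
  simpa [Function.comp_def] using this

/-- Points where the oscillation is not locally below `1 / (n + 1)` are isolated from the right
among themselves, because right limits exist. A set of points isolated from the right is countable.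
-/
theorem countable_not_continuousAt {F : ℝ → ℝ} {a b C : ℝ} (h : HarmonicVarLE F (Icc a b) C) :
    {x ∈ Ioo a b | ¬ ContinuousAt F x}.Countable := by
  let D : ℕ → Set ℝ := fun n => {x ∈ Ioo a b | ¬ ∃ U ∈ 𝓝 x, ∀ u ∈ U, ∀ v ∈ U,
    |F u - F v| < 1 / ((n : ℝ) + 1)}
  have hD : ∀ n, (D n).Countable := by
    intro n
    refine (countable_setOfPred_isolated_right_within (s := D n)).mono fun x hx => ?_
    refine ⟨hx, ?_⟩
    obtain ⟨δ, hδ, hδb, h2⟩ := (h.mono (T := Ioc x b)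
      fun t ht => ⟨hx.1.1.le.trans ht.1.le, ht.2⟩).exists_oscillation_lt hx.1.2
      (ε := 1 / ((n : ℝ) + 1)) (by positivity)
    rw [← Filter.empty_mem_iff_bot, mem_nhdsWithin]
    refine ⟨Iio δ, isOpen_Iio, hδ, fun y hy => ?_⟩
    exact hy.2.1.2 ⟨Ioo x δ, isOpen_Ioo.mem_nhds ⟨hy.2.2, hy.1⟩, h2⟩
  refine (countable_iUnion hD).mono fun x hx => ?_
  rw [mem_iUnion]
  by_contra! hcon
  refine hx.2 ?_
  rw [Metric.continuousAt_iff']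
  intro ε hε
  obtain ⟨n, hn⟩ := exists_nat_one_div_lt hε
  have : ∃ U ∈ 𝓝 x, ∀ u ∈ U, ∀ v ∈ U, |F u - F v| < 1 / ((n : ℝ) + 1) := by
    by_contra h'
    exact hcon n ⟨hx.1, h'⟩
  obtain ⟨U, hU, h2⟩ := this
  filter_upwards [hU] with y hy
  exact (h2 y hy x (mem_of_mem_nhds hU)).trans hn

theorem intervalIntegrable {F : ℝ → ℝ} {a b C : ℝ} (h : HarmonicVarLE F (Icc a b) C)
    (hab : a ≤ b) : IntervalIntegrable F volume a b := by
  rw [intervalIntegrable_iff_integrableOn_Ioo_of_le hab]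
  set D := {x ∈ Ioo a b | ¬ ContinuousAt F x} with hD
  have hDc : D.Countable := h.countable_not_continuousAt
  have hmeas : AEStronglyMeasurable F (volume.restrict (Ioo a b)) := by
    have h1 : AEStronglyMeasurable F (volume.restrict (Ioo a b \ D)) := by
      refine ContinuousOn.aestronglyMeasurable (fun x hx => ?_)
        (measurableSet_Ioo.diff hDc.measurableSet)
      refine ContinuousAt.continuousWithinAt ?_
      by_contra hc
      exact hx.2 ⟨hx.1, hc⟩
    rwa [Measure.restrict_congr_set (sdiff_null_ae_eq_self (hDc.measure_zero _))] at h1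
  refine Integrable.of_bound (C := |F a| + C) hmeas ?_
  filter_upwards [ae_restrict_mem measurableSet_Ioo] with t ht
  have := h.abs_sub_le (Ioo_subset_Icc_self ht) (left_mem_Icc.2 hab)
  rw [Real.norm_eq_abs]
  have h3 := abs_add_le (F t - F a) (F a)
  rw [sub_add_cancel] at h3
  linarith

end HarmonicVarLE

namespace HarmonicVarLE

/-- The harmonic variation on `(0, δ]` of a function with right limit `0` at `0` tends to `0`
with `δ`. -/
theorem exists_small {F : ℝ → ℝ} {b C : ℝ} (h : HarmonicVarLE F (Ioc 0 b) C) (hb : 0 < b)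
    (hF : Tendsto F (𝓝[>] 0) (𝓝 0)) {ε : ℝ} (hε : 0 < ε) :
    ∃ δ > 0, δ ≤ b ∧ HarmonicVarLE F (Ioc 0 δ) ε := by
  by_contra! hcon
  -- If the variation exceeds `ε` on every `(0, η]`, indices at least `N` alone carry `ε / 2`: near
  -- `0` the fewer than `N` remaining terms are each at most `ε / (2 * (N + 1))`.
  have stepA : ∀ N : ℕ, ∀ η > 0, η ≤ b → ∃ (s : Finset ℕ) (u v : ℕ → ℝ),
      (∀ i ∈ s, u i ≤ v i ∧ u i ∈ Ioc 0 η ∧ v i ∈ Ioc 0 η) ∧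
      (∀ i ∈ s, ∀ j ∈ s, i ≠ j → v i ≤ u j ∨ v j ≤ u i) ∧ (∀ i ∈ s, N ≤ i) ∧
      ε / 2 ≤ ∑ i ∈ s, |F (v i) - F (u i)| / ((i : ℝ) + 1) := by
    intro N η hη hηb
    have hN : (0 : ℝ) < N + 1 := by positivity
    have hev : ∀ᶠ t in 𝓝[>] (0 : ℝ), |F t| < ε / (4 * (N + 1)) := by
      have := hF.abs
      rw [abs_zero] at this
      exact this.eventually (gt_mem_nhds (by positivity))
    obtain ⟨δ, hδ, hδ'⟩ := mem_nhdsGT_iff_exists_Ioc_subset.1 hev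
    have hm : 0 < min δ η := lt_min hδ hη
    have := hcon (min δ η) hm ((min_le_right _ _).trans hηb)
    unfold HarmonicVarLE at this
    push Not at this
    obtain ⟨s, u, v, h1, h2, h3⟩ := this
    refine ⟨s.filter (N ≤ ·), u, v, fun i hi => ?_, fun i hi j hj => ?_, fun i hi => ?_, ?_⟩
    · obtain ⟨h4, h5, h6⟩ := h1 i (Finset.mem_filter.1 hi).1
      exact ⟨h4, ⟨h5.1, h5.2.trans (min_le_right _ _)⟩, ⟨h6.1, h6.2.trans (min_le_right _ _)⟩⟩
    · exact h2 i (Finset.mem_filter.1 hi).1 j (Finset.mem_filter.1 hj).1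
    · exact (Finset.mem_filter.1 hi).2
    · rw [← Finset.sum_filter_add_sum_filter_not s (N ≤ ·)] at h3
      have h4 : ∑ i ∈ s with ¬ N ≤ i, |F (v i) - F (u i)| / ((i : ℝ) + 1) ≤ ε / 2 := by
        calc _ ≤ ∑ i ∈ s with ¬ N ≤ i, ε / (2 * (N + 1)) := by
              refine Finset.sum_le_sum fun i hi => ?_
              obtain ⟨h4, h5, h6⟩ := h1 i (Finset.mem_filter.1 hi).1
              have e1 : |F (u i)| < _ := hδ' ⟨h5.1, h5.2.trans (min_le_left _ _)⟩
              have e2 : |F (v i)| < _ := hδ' ⟨h6.1, h6.2.trans (min_le_left _ _)⟩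
              have e3 : ε / (2 * ((N : ℝ) + 1)) = ε / (4 * (N + 1)) + ε / (4 * (N + 1)) := by
                field_simp; norm_num
              refine (div_le_self (abs_nonneg _) (by linarith [i.cast_nonneg (α := ℝ)])).trans ?_
              rw [e3]
              exact (abs_sub _ _).trans (add_le_add e2.le e1.le)
          _ ≤ N * (ε / (2 * (N + 1))) := by
              rw [Finset.sum_const, nsmul_eq_mul]
              gcongr
              calc _ ≤ (Finset.range N).card := Finset.card_le_card fun i hi => by
                    simpa using (Finset.mem_filter.1 hi).2
                _ = N := Finset.card_range N
          _ ≤ ε / 2 := by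
              rw [← mul_div_assoc, div_le_div_iff₀ (by positivity) (by positivity)]
              nlinarith
      linarith
  -- Families from `stepA` are stacked towards `0`, each placed to the left of the earlier ones and
  -- using only larger indices. The union is admissible and its sum is unbounded in `m`.
  have stepB : ∀ m : ℕ, ∃ η > 0, η ≤ b ∧ ∃ (s : Finset ℕ) (u v : ℕ → ℝ),
      (∀ i ∈ s, u i ≤ v i ∧ η ≤ u i ∧ v i ≤ b) ∧
      (∀ i ∈ s, ∀ j ∈ s, i ≠ j → v i ≤ u j ∨ v j ≤ u i) ∧
      m * (ε / 2) ≤ ∑ i ∈ s, |F (v i) - F (u i)| / ((i : ℝ) + 1) := by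
    intro m
    induction m with
    | zero => exact ⟨b, hb, le_rfl, ∅, 0, 0, by simp, by simp, by simp⟩
    | succ m ih =>
      obtain ⟨η, hη, hηb, s, u, v, h1, h2, h3⟩ := ih
      obtain ⟨s', u', v', h1', h2', hN, h3'⟩ := stepA (s.sup id + 1) η hη hηb
      have hlt : ∀ i ∈ s', i ∉ s := fun i hi hi' => by
        have := hN i hi
        have := Finset.le_sup (f := id) hi'
        simp only [id] at this
        omega
      have hdisj : Disjoint s s' := Finset.disjoint_left.2 fun i hi hi' => hlt i hi' hi
      obtain ⟨η', hη', hη'η, hmin⟩ : ∃ η' > 0, η' ≤ η ∧ ∀ i ∈ s', η' ≤ u' i := by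
        refine ⟨(insert η (s'.image u')).min' (Finset.insert_nonempty _ _), ?_, ?_, ?_⟩
        · rw [gt_iff_lt, Finset.lt_min'_iff]
          intro y hy
          rw [Finset.mem_insert, Finset.mem_image] at hy
          rcases hy with rfl | ⟨i, hi, rfl⟩
          · exact hη
          · exact (h1' i hi).2.1.1
        · exact Finset.min'_le _ _ (Finset.mem_insert_self _ _)
        · exact fun i hi => Finset.min'_le _ _
            (Finset.mem_insert_of_mem (Finset.mem_image_of_mem _ hi))
      classical
      refine ⟨η', hη', hη'η.trans hηb, s ∪ s', fun i => if i ∈ s then u i else u' i,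
        fun i => if i ∈ s then v i else v' i, fun i hi => ?_, fun i hi j hj hij => ?_, ?_⟩
      · by_cases his : i ∈ s
        · simp only [his, if_true]
          exact ⟨(h1 i his).1, hη'η.trans (h1 i his).2.1, (h1 i his).2.2⟩
        · have hi' : i ∈ s' := (Finset.mem_union.1 hi).resolve_left his
          simp only [his, if_false]
          exact ⟨(h1' i hi').1, hmin i hi', (h1' i hi').2.2.2.trans hηb⟩
      · by_cases his : i ∈ s <;> by_cases hjs : j ∈ s <;> simp only [his, hjs, if_true, if_false]
        · exact h2 i his j hjs hij
        · have hj' : j ∈ s' := (Finset.mem_union.1 hj).resolve_left hjs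
          exact Or.inr ((h1' j hj').2.2.2.trans (h1 i his).2.1)
        · have hi' : i ∈ s' := (Finset.mem_union.1 hi).resolve_left his
          exact Or.inl ((h1' i hi').2.2.2.trans (h1 j hjs).2.1)
        · exact h2' i ((Finset.mem_union.1 hi).resolve_left his) j
            ((Finset.mem_union.1 hj).resolve_left hjs) hij
      · rw [Finset.sum_union hdisj]
        push_cast
        rw [add_mul, one_mul]
        refine add_le_add (h3.trans (le_of_eq ?_)) (h3'.trans (le_of_eq ?_))
        · exact Finset.sum_congr rfl fun i hi => by simp [hi]
        · exact Finset.sum_congr rfl fun i hi => by simp [hlt i hi]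
  obtain ⟨m, hm⟩ := exists_nat_gt (C / (ε / 2))
  obtain ⟨η, hη, hηb, s, u, v, h1, h2, h3⟩ := stepB m
  have := h s u v (fun i hi => ⟨(h1 i hi).1, ⟨hη.trans_le (h1 i hi).2.1,
    (h1 i hi).1.trans (h1 i hi).2.2⟩, ⟨(hη.trans_le (h1 i hi).2.1).trans_le (h1 i hi).1,
    (h1 i hi).2.2⟩⟩) h2
  rw [div_lt_iff₀ (by positivity)] at hm
  linarith

end HarmonicVarLE

/-! ### Integrals against oscillating kernels -/

/-- A sequence of kernels `G n` on `(0, π]` with primitives `B n` which oscillate and decay at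
scale `1 / n`, so that integrals against `G n` are controlled by the harmonic variation. -/
structure IsHarmonicKernel (G B : ℕ → ℝ → ℝ) (C : ℝ) : Prop where
  continuous : ∀ n, Continuous (G n)
  hasDerivAt : ∀ n, 1 ≤ n → ∀ t ∈ Ioc 0 Real.pi, HasDerivAt (B n) (G n t) t
  abs_le_mul : ∀ n, 1 ≤ n → ∀ t ∈ Ioc 0 Real.pi, |G n t| ≤ C * n
  abs_le_div : ∀ n, 1 ≤ n → ∀ t ∈ Ioc 0 Real.pi, |G n t| ≤ C / t
  abs_primitive_le : ∀ n, 1 ≤ n → ∀ t ∈ Ioc 0 Real.pi, |B n t| ≤ C / (n * t)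
  tendsto_integral_zero : ∀ δ ∈ Ioo 0 Real.pi, ∀ g : ℝ → ℝ,
    IntervalIntegrable g volume δ Real.pi →
    Tendsto (fun n => ∫ t in δ..Real.pi, g t * G n t) atTop (𝓝 0)

theorem sum_range_mul_sub_eq (a b : ℕ → ℝ) (m : ℕ) :
    ∑ k ∈ Finset.range m, a k * (b (k + 1) - b k) =
      a m * b m - a 0 * b 0 - ∑ k ∈ Finset.range m, (a (k + 1) - a k) * b (k + 1) := by
  induction m with
  | zero => simp
  | succ m ih => rw [Finset.sum_range_succ, Finset.sum_range_succ, ih]; ring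

namespace IsHarmonicKernel

theorem nonneg {G B : ℕ → ℝ → ℝ} {C : ℝ} (hK : IsHarmonicKernel G B C) : 0 ≤ C := by
  have := (abs_nonneg _).trans (hK.abs_le_mul 1 le_rfl Real.pi ⟨Real.pi_pos, le_rfl⟩)
  simpa using this

/-- The contribution of the deviation of `F` from a step function of step `h`. -/
theorem sum_abs_integral_sub_le {F : ℝ → ℝ} {g : ℝ → ℝ} {δ V C h : ℝ} {m : ℕ} (hh : 0 < h)
    (hC : 0 ≤ C) (hδ : ((m : ℝ) + 1) * h = δ) (hFi : IntervalIntegrable F volume 0 δ)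
    (hV : HarmonicVarLE F (Ioc 0 δ) V) (hg : Continuous g)
    (hgle : ∀ t ∈ Ioc 0 δ, |g t| ≤ C / t) :
    ∑ k ∈ Finset.range m, |∫ t in ((k : ℝ) + 1) * h..((k : ℝ) + 2) * h,
      (F t - F (((k : ℝ) + 1) * h)) * g t| ≤ C * V := by
  have hbd : ∀ k ∈ Finset.range m, ((k : ℝ) + 2) * h ≤ δ := fun k hk => by
    rw [← hδ]
    have : (k : ℝ) + 1 ≤ m := by exact_mod_cast Finset.mem_range.1 hk
    nlinarith
  have hsub : ∀ k ∈ Finset.range m,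
      IntervalIntegrable F volume (((k : ℝ) + 1) * h) (((k : ℝ) + 2) * h) := fun k hk => by
    refine hFi.mono_set ?_
    rw [uIcc_of_le (by nlinarith), uIcc_of_le (by rw [← hδ]; positivity)]
    exact Icc_subset_Icc (by positivity) (hbd k hk)
  have hshift : ∀ k ∈ Finset.range m, IntervalIntegrable
      (fun s => |F (((k : ℝ) + 1) * h + s) - F (((k : ℝ) + 1) * h)| / ((k : ℝ) + 1))
      volume 0 h := fun k hk => by
    have h1 := ((hsub k hk).sub
      (intervalIntegrable_const (c := F (((k : ℝ) + 1) * h)))).abs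
    have h2 := (h1.comp_add_left (((k : ℝ) + 1) * h)).div_const ((k : ℝ) + 1)
    convert h2 using 1 <;> ring
  have hterm : ∀ k ∈ Finset.range m, |∫ t in ((k : ℝ) + 1) * h..((k : ℝ) + 2) * h,
      (F t - F (((k : ℝ) + 1) * h)) * g t| ≤ ∫ s in (0 : ℝ)..h, C / h *
        (|F (((k : ℝ) + 1) * h + s) - F (((k : ℝ) + 1) * h)| / ((k : ℝ) + 1)) := fun k hk => by
    have hle : ((k : ℝ) + 1) * h ≤ ((k : ℝ) + 2) * h := by nlinarith
    have hpos : 0 < ((k : ℝ) + 1) * h := by positivity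
    have e1 : ∫ s in (0 : ℝ)..h, C / h *
        (|F (((k : ℝ) + 1) * h + s) - F (((k : ℝ) + 1) * h)| / ((k : ℝ) + 1)) =
        ∫ t in ((k : ℝ) + 1) * h..((k : ℝ) + 2) * h,
          C / h * (|F t - F (((k : ℝ) + 1) * h)| / ((k : ℝ) + 1)) := by
      rw [intervalIntegral.integral_comp_add_left (fun t => C / h *
        (|F t - F (((k : ℝ) + 1) * h)| / ((k : ℝ) + 1)))]
      congr 1 <;> ring
    rw [e1]
    refine (intervalIntegral.abs_integral_le_integral_abs hle).trans ?_
    refine intervalIntegral.integral_mono_on hle ?_ ?_ fun t ht => ?_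
    · exact (((hsub k hk).sub intervalIntegrable_const).mul_continuousOn hg.continuousOn).abs
    · exact ((((hsub k hk).sub intervalIntegrable_const).abs).div_const _).const_mul _
    · rw [abs_mul]
      have h3 : |g t| ≤ C / (((k : ℝ) + 1) * h) :=
        (hgle t ⟨hpos.trans_le ht.1, ht.2.trans (hbd k hk)⟩).trans
          (div_le_div_of_nonneg_left hC hpos ht.1)
      refine (mul_le_mul_of_nonneg_left h3 (abs_nonneg _)).trans (le_of_eq ?_)
      field_simp
  refine (Finset.sum_le_sum hterm).trans ?_
  -- With all pieces translated to `[0, h]`, sum and integral are exchanged. For fixed `s` the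
  -- intervals from `(k + 1) * h` to `(k + 1) * h + s` do not overlap, so the integrand is at most
  -- `C / h * V`.
  rw [← intervalIntegral.integral_finsetSum fun k hk => (hshift k hk).const_mul _]
  calc _ ≤ ∫ s in (0 : ℝ)..h, C / h * V := by
        refine intervalIntegral.integral_mono_on_of_le_Ioo hh.le ?_ intervalIntegrable_const
          fun s hs => ?_
        · have := IntervalIntegrable.sum (Finset.range m) fun k hk => (hshift k hk).const_mul (C / h)
          convert! this using 1
          ext s
          simp
        · rw [← Finset.mul_sum]
          refine mul_le_mul_of_nonneg_left ?_ (by positivity)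
          refine hV (Finset.range m) (fun k => ((k : ℝ) + 1) * h)
            (fun k => ((k : ℝ) + 1) * h + s) (fun k hk => ?_) (fun i hi j hj hij => ?_)
          · have := hbd k hk
            have h4 : 0 < ((k : ℝ) + 1) * h := by positivity
            have hs1 := hs.1
            have hs2 := hs.2
            exact ⟨by linarith, ⟨h4, by linarith⟩, ⟨by linarith, by linarith⟩⟩
          · have : ∀ i j : ℕ, i < j → ((i : ℝ) + 1) * h + s ≤ ((j : ℝ) + 1) * h := by
              intro i j hij
              have : (i : ℝ) + 1 ≤ j := by exact_mod_cast hij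
              nlinarith [hs.2]
            rcases lt_or_gt_of_ne hij with h | h
            · exact Or.inl (this i j h)
            · exact Or.inr (this j i h)
    _ = C * V := by
        rw [intervalIntegral.integral_const, smul_eq_mul]
        field_simp
        ring

/-- The first piece costs `C * S` by the bound `C * n`. On the others `F` is replaced by its left
endpoint value, at a cost of `C * V`. The resulting step function is summed by parts against `B n`,
costing `4 * C * S` for the two boundary terms and `2 * C * V` for the differences. -/
theorem abs_integral_le {G B : ℕ → ℝ → ℝ} {C : ℝ} (hK : IsHarmonicKernel G B C) {F : ℝ → ℝ}
    {δ S V : ℝ} {n : ℕ} (hn : 1 ≤ n) (hδ : 0 < δ) (hδπ : δ ≤ Real.pi) (hnδ : 1 ≤ n * δ)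
    (hFi : IntervalIntegrable F volume 0 δ) (hS : ∀ t ∈ Ioc 0 δ, |F t| ≤ S)
    (hV : HarmonicVarLE F (Ioc 0 δ) V) :
    |∫ t in (0 : ℝ)..δ, F t * G n t| ≤ C * (5 * S + 3 * V) := by
  have hC := hK.nonneg
  have hn0 : (0 : ℝ) < n := by exact_mod_cast hn
  have hS0 : 0 ≤ S := (abs_nonneg _).trans (hS δ ⟨hδ, le_rfl⟩)
  -- The number `m + 1` of pieces is chosen so that their length `h` satisfies `1 / 2 ≤ n * h ≤ 1`.
  -- The lower bound uses `1 ≤ n * δ`.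
  obtain ⟨m, hm⟩ : ∃ m, ⌈n * δ⌉₊ = m + 1 :=
    Nat.exists_eq_succ_of_ne_zero (Nat.ceil_pos.2 (by positivity)).ne'
  have hM1 : n * δ ≤ (m : ℝ) + 1 := by
    have := Nat.le_ceil (n * δ)
    rw [hm] at this
    exact_mod_cast this
  have hM2 : (m : ℝ) + 1 ≤ 2 * (n * δ) := by
    have := Nat.ceil_lt_add_one (a := n * δ) (by positivity)
    rw [hm] at this
    push_cast at this
    linarith
  set h := δ / ((m : ℝ) + 1) with hh_def
  have hh : 0 < h := by positivity
  have hmh : ((m : ℝ) + 1) * h = δ := by rw [hh_def]; field_simp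
  have hnh1 : n * h ≤ 1 := by
    rw [hh_def, ← mul_div_assoc, div_le_one (by positivity)]; exact hM1
  have hnh2 : 1 / 2 ≤ n * h := by
    rw [hh_def, ← mul_div_assoc, le_div_iff₀ (by positivity)]; linarith
  have hmem : ∀ k : ℕ, k ≤ m → ((k : ℝ) + 1) * h ∈ Ioc 0 δ := fun k hk => by
    refine ⟨by positivity, ?_⟩
    rw [← hmh]
    have : (k : ℝ) ≤ m := by exact_mod_cast hk
    gcongr
  have hFG : IntervalIntegrable (fun t => F t * G n t) volume 0 δ :=
    hFi.mul_continuousOn (hK.continuous n).continuousOn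
  have hsubset : ∀ k : ℕ, k ≤ m → uIcc ((k : ℝ) * h) (((k : ℝ) + 1) * h) ⊆ uIcc 0 δ :=
    fun k hk => by
      rw [uIcc_of_le (by nlinarith), uIcc_of_le hδ.le]
      exact Icc_subset_Icc (by positivity) (hmem k hk).2
  have hsplit : ∫ t in (0 : ℝ)..δ, F t * G n t =
      ∑ k ∈ Finset.range (m + 1), ∫ t in (k : ℝ) * h..((k + 1 : ℕ) : ℝ) * h, F t * G n t := by
    rw [intervalIntegral.sum_integral_adjacent_intervals (a := fun k : ℕ => (k : ℝ) * h)]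
    · simp [hmh]
    · intro k hk
      refine hFG.mono_set ?_
      push_cast
      exact hsubset k (Nat.lt_succ_iff.1 hk)
  have hpiece : ∀ k ∈ Finset.range m,
      ∫ t in ((k + 1 : ℕ) : ℝ) * h..((k + 1 + 1 : ℕ) : ℝ) * h, F t * G n t =
      (∫ t in ((k : ℝ) + 1) * h..((k : ℝ) + 2) * h, (F t - F (((k : ℝ) + 1) * h)) * G n t) +
        F (((k : ℝ) + 1) * h) * (B n (((k : ℝ) + 2) * h) - B n (((k : ℝ) + 1) * h)) := by
    intro k hk
    have hk' : k + 1 ≤ m := Finset.mem_range.1 hk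
    have hle : ((k : ℝ) + 1) * h ≤ ((k : ℝ) + 2) * h := by nlinarith
    have hint : IntervalIntegrable F volume (((k : ℝ) + 1) * h) (((k : ℝ) + 2) * h) := by
      refine hFi.mono_set ?_
      have := hsubset (k + 1) hk'
      push_cast at this
      rwa [add_assoc, one_add_one_eq_two] at this
    have hB : ∫ t in ((k : ℝ) + 1) * h..((k : ℝ) + 2) * h, G n t =
        B n (((k : ℝ) + 2) * h) - B n (((k : ℝ) + 1) * h) := by
      refine intervalIntegral.integral_eq_sub_of_hasDerivAt (fun t ht => ?_)
        ((hK.continuous n).intervalIntegrable _ _)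
      rw [uIcc_of_le hle] at ht
      have h1 := (hmem k (by omega)).1
      have h2 := (hmem (k + 1) hk').2
      push_cast at h2
      rw [add_assoc, one_add_one_eq_two] at h2
      exact hK.hasDerivAt n hn t ⟨h1.trans_le ht.1, (ht.2.trans h2).trans hδπ⟩
    rw [← hB, ← intervalIntegral.integral_const_mul, ← intervalIntegral.integral_add]
    · push_cast
      rw [add_assoc (k : ℝ) 1 1, one_add_one_eq_two]
      exact intervalIntegral.integral_congr fun t _ => by ring
    · exact (hint.sub intervalIntegrable_const).mul_continuousOn (hK.continuous n).continuousOn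
    · exact ((hK.continuous n).intervalIntegrable _ _).const_mul _
  have hfirst : |∫ t in (0 : ℝ)..h, F t * G n t| ≤ C * S := by
    have := intervalIntegral.norm_integral_le_of_norm_le_const (a := 0) (b := h)
      (f := fun t => F t * G n t) (C := S * (C * n)) fun t ht => by
        rw [uIoc_of_le hh.le] at ht
        have h1 : t ≤ δ := by
          have := (hmem 0 (Nat.zero_le _)).2
          simp only [Nat.cast_zero, zero_add, one_mul] at this
          exact ht.2.trans this
        rw [norm_mul, Real.norm_eq_abs, Real.norm_eq_abs]
        exact mul_le_mul (hS t ⟨ht.1, h1⟩) (hK.abs_le_mul n hn t ⟨ht.1, h1.trans hδπ⟩)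
          (abs_nonneg _) hS0
    rw [Real.norm_eq_abs, sub_zero, abs_of_pos hh] at this
    refine this.trans ?_
    calc S * (C * n) * h = C * S * (n * h) := by ring
      _ ≤ C * S * 1 := by gcongr
      _ = C * S := mul_one _
  have hBk : ∀ k : ℕ, k ≤ m → |B n (((k : ℝ) + 1) * h)| ≤ 2 * C / ((k : ℝ) + 1) := by
    intro k hk
    refine (hK.abs_primitive_le n hn _ ⟨(hmem k hk).1, (hmem k hk).2.trans hδπ⟩).trans ?_
    rw [div_le_div_iff₀ (by positivity) (by positivity)]
    calc C * ((k : ℝ) + 1) = 2 * C * ((k : ℝ) + 1) * (1 / 2) := by ring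
      _ ≤ 2 * C * ((k : ℝ) + 1) * (n * h) := by gcongr
      _ = _ := by ring
  have habel := sum_range_mul_sub_eq (fun k => F (((k : ℝ) + 1) * h))
    (fun k => B n (((k : ℝ) + 1) * h)) m
  push_cast at habel
  simp only [zero_add, one_mul, add_assoc, one_add_one_eq_two] at habel
  have hvar : |∑ k ∈ Finset.range m, (F (((k : ℝ) + 2) * h) - F (((k : ℝ) + 1) * h)) *
      B n (((k : ℝ) + 2) * h)| ≤ 2 * C * V := by
    refine (Finset.abs_sum_le_sum_abs _ _).trans ?_
    calc _ ≤ ∑ k ∈ Finset.range m, 2 * C *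
          (|F (((k : ℝ) + 2) * h) - F (((k : ℝ) + 1) * h)| / ((k : ℝ) + 1)) := by
          refine Finset.sum_le_sum fun k hk => ?_
          have h1 := hBk (k + 1) (Finset.mem_range.1 hk)
          push_cast at h1
          rw [add_assoc, one_add_one_eq_two] at h1
          rw [abs_mul]
          have h2 : 2 * C / ((k : ℝ) + 2) ≤ 2 * C / ((k : ℝ) + 1) := by
            gcongr; norm_num
          refine (mul_le_mul_of_nonneg_left (h1.trans h2) (abs_nonneg _)).trans (le_of_eq ?_)
          ring
      _ ≤ 2 * C * V := by
          rw [← Finset.mul_sum]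
          refine mul_le_mul_of_nonneg_left ?_ (by positivity)
          refine hV (Finset.range m) (fun k => ((k : ℝ) + 1) * h)
            (fun k => ((k : ℝ) + 2) * h) (fun k hk => ?_) (fun i hi j hj hij => ?_)
          · have h1 := hmem (k + 1) (Finset.mem_range.1 hk)
            push_cast at h1
            rw [add_assoc, one_add_one_eq_two] at h1
            exact ⟨by nlinarith, hmem k (Finset.mem_range.1 hk).le, h1⟩
          · have : ∀ i j : ℕ, i < j → ((i : ℝ) + 2) * h ≤ ((j : ℝ) + 1) * h := by
              intro i j hij
              have : (i : ℝ) + 1 ≤ j := by exact_mod_cast hij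
              nlinarith
            rcases lt_or_gt_of_ne hij with h | h
            · exact Or.inl (this i j h)
            · exact Or.inr (this j i h)
  have hend : ∀ k : ℕ, k ≤ m → |F (((k : ℝ) + 1) * h) * B n (((k : ℝ) + 1) * h)| ≤
      2 * C * S := by
    intro k hk
    rw [abs_mul]
    have h1 : 2 * C / ((k : ℝ) + 1) ≤ 2 * C :=
      div_le_self (by positivity) (by linarith [k.cast_nonneg (α := ℝ)])
    calc _ ≤ S * (2 * C) := mul_le_mul (hS _ (hmem k hk)) ((hBk k hk).trans h1)
          (abs_nonneg _) hS0
      _ = _ := by ring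
  have hend0 := hend 0 (Nat.zero_le _)
  simp only [Nat.cast_zero, zero_add, one_mul] at hend0
  have hendm := hend m le_rfl
  have hdev := sum_abs_integral_sub_le (m := m) hh hC hmh hFi hV (hK.continuous n)
    fun t ht => hK.abs_le_div n hn t ⟨ht.1, ht.2.trans hδπ⟩
  have hdev' := (Finset.abs_sum_le_sum_abs _ _).trans hdev
  rw [hsplit, Finset.sum_range_succ', Finset.sum_congr rfl hpiece, Finset.sum_add_distrib, habel]
  simp only [Nat.cast_zero, zero_mul, zero_add, Nat.cast_one, one_mul]
  rw [abs_le] at *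
  constructor <;> linarith [hfirst.1, hfirst.2, hend0.1, hend0.2, hendm.1, hendm.2, hdev'.1,
    hdev'.2, hvar.1, hvar.2]

theorem tendsto_integral {G B : ℕ → ℝ → ℝ} {C : ℝ} (hK : IsHarmonicKernel G B C) {γ : ℝ}
    (hγ : Tendsto (fun n => ∫ t in (0 : ℝ)..Real.pi, G n t) atTop (𝓝 γ)) {F : ℝ → ℝ} {V l : ℝ}
    (hFi : IntervalIntegrable F volume 0 Real.pi) (hV : HarmonicVarLE F (Ioc 0 Real.pi) V)
    (hl : Tendsto F (𝓝[>] 0) (𝓝 l)) :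
    Tendsto (fun n => ∫ t in (0 : ℝ)..Real.pi, F t * G n t) atTop (𝓝 (l * γ)) := by
  have hpi := Real.pi_pos
  have hC := hK.nonneg
  have hF'i : IntervalIntegrable (fun t => F t - l) volume 0 Real.pi :=
    hFi.sub intervalIntegrable_const
  have hF'0 : Tendsto (fun t => F t - l) (𝓝[>] 0) (𝓝 0) := by simpa using hl.sub_const l
  suffices hmain : Tendsto (fun n => ∫ t in (0 : ℝ)..Real.pi, (F t - l) * G n t) atTop (𝓝 0) by
    have := hmain.add (hγ.const_mul l)
    rw [zero_add] at this
    refine this.congr fun n => ?_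
    rw [← intervalIntegral.integral_const_mul, ← intervalIntegral.integral_add]
    · exact intervalIntegral.integral_congr fun t _ => by ring
    · exact hF'i.mul_continuousOn (hK.continuous n).continuousOn
    · exact ((hK.continuous n).intervalIntegrable _ _).const_mul _
  rw [Metric.tendsto_atTop']
  intro ε hε
  -- With supremum and variation at most `η` near `0`, `abs_integral_le` gives `8 * C * η ≤ ε / 2`.
  set η := ε / (2 * (8 * C + 1)) with hη_def
  have hη : 0 < η := by positivity
  obtain ⟨δ₁, hδ₁, hδ₁π, hvar⟩ := (hV.sub_const l).exists_small hpi hF'0 hη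
  have hev : ∀ᶠ t in 𝓝[>] (0 : ℝ), |F t - l| < η := by
    have := hF'0.abs
    rw [abs_zero] at this
    exact this.eventually (gt_mem_nhds hη)
  obtain ⟨δ₂, hδ₂, hδ₂'⟩ := mem_nhdsGT_iff_exists_Ioc_subset.1 hev
  set δ := min (min δ₁ δ₂) (Real.pi / 2)
  have hδ : 0 < δ := lt_min (lt_min hδ₁ hδ₂) (by positivity)
  have hδπ : δ < Real.pi := (min_le_right _ _).trans_lt (by linarith)
  have hδδ₁ : δ ≤ δ₁ := (min_le_left _ _).trans (min_le_left _ _)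
  have hδδ₂ : δ ≤ δ₂ := (min_le_left _ _).trans (min_le_right _ _)
  have h0δ : IntervalIntegrable (fun t => F t - l) volume 0 δ := hF'i.mono_set <| by
    rw [uIcc_of_le hδ.le, uIcc_of_le hpi.le]; exact Icc_subset_Icc_right hδπ.le
  have hδpi : IntervalIntegrable (fun t => F t - l) volume δ Real.pi := hF'i.mono_set <| by
    rw [uIcc_of_le hδπ.le, uIcc_of_le hpi.le]; exact Icc_subset_Icc_left hδ.le
  have hfar := (hK.tendsto_integral_zero δ ⟨hδ, hδπ⟩ _ hδpi).eventually
    (Metric.ball_mem_nhds 0 (half_pos hε))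
  obtain ⟨N, hN⟩ := eventually_atTop.1 hfar
  obtain ⟨N', hN'⟩ := exists_nat_gt (1 / δ)
  refine ⟨max N (max N' 1), fun n hn => ?_⟩
  have hnN : N ≤ n := (le_max_left _ _).trans hn.le
  have hnN' : (N' : ℝ) ≤ n := by
    exact_mod_cast ((le_max_left _ _).trans (le_max_right _ _)).trans hn.le
  have hn1 : 1 ≤ n := ((le_max_right _ _).trans (le_max_right _ _)).trans hn.le
  have hnδ : 1 ≤ n * δ := by
    rw [div_lt_iff₀ hδ] at hN'
    nlinarith
  have hnear := hK.abs_integral_le hn1 hδ hδπ.le hnδ h0δ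
    (fun t ht => (hδ₂' ⟨ht.1, ht.2.trans hδδ₂⟩ : |F t - l| < η).le)
    (hvar.mono (Ioc_subset_Ioc_right hδδ₁))
  have h2 := hN n hnN
  rw [dist_zero_right, Real.norm_eq_abs] at h2
  rw [dist_zero_right, Real.norm_eq_abs,
    ← intervalIntegral.integral_add_adjacent_intervals
      (h0δ.mul_continuousOn (hK.continuous n).continuousOn)
      (hδpi.mul_continuousOn (hK.continuous n).continuousOn)]
  have h3 : C * (5 * η + 3 * η) ≤ ε / 2 := by
    have : ε / 2 = (8 * C + 1) * η := by rw [hη_def]; field_simp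
    rw [this]
    nlinarith
  refine (abs_add_le _ _).trans_lt ?_
  linarith

end IsHarmonicKernel

/-! ### The Riemann–Lebesgue lemma on an interval -/

theorem tendsto_integral_mul_cexp {a b : ℝ} (hab : a ≤ b) (g : ℝ → ℝ) :
    Tendsto (fun c : ℝ => ∫ t in a..b, Complex.exp (-(c * t : ℝ) * Complex.I) * (g t : ℂ))
      atTop (𝓝 0) := by
  have hpi := Real.pi_pos
  have h1 := (Real.tendsto_integral_exp_smul_cocompact
    (indicator (Ioc a b) fun t => (g t : ℂ))).mono_left atTop_le_cocompact
  have h2 : Tendsto (fun c : ℝ => c / (2 * Real.pi)) atTop atTop :=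
    tendsto_id.atTop_div_const (by positivity)
  refine (h1.comp h2).congr fun c => ?_
  simp only [Function.comp_apply]
  rw [intervalIntegral.integral_of_le hab, ← integral_indicator measurableSet_Ioc]
  congr 1
  ext t
  by_cases ht : t ∈ Ioc a b
  · simp only [indicator_of_mem ht, Circle.smul_def, Real.fourierChar_apply, smul_eq_mul]
    congr 3
    rw [← Complex.ofReal_neg]
    congr 1
    field_simp
  · simp [indicator_of_notMem ht]

theorem integrable_cexp_mul {a b : ℝ} {g : ℝ → ℝ} (hg : IntervalIntegrable g volume a b) (c : ℝ) :
    IntervalIntegrable (fun t => Complex.exp (-(c * t : ℝ) * Complex.I) * (g t : ℂ))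
      volume a b := by
  have : IntervalIntegrable (fun t => (g t : ℂ)) volume a b := ⟨hg.1.ofReal, hg.2.ofReal⟩
  exact this.continuousOn_mul (by fun_prop)

/-- **Riemann–Lebesgue lemma** for cosine integrals over an interval. -/
theorem tendsto_integral_mul_cos {a b : ℝ} (hab : a ≤ b) {g : ℝ → ℝ}
    (hg : IntervalIntegrable g volume a b) :
    Tendsto (fun c : ℝ => ∫ t in a..b, g t * Real.cos (c * t)) atTop (𝓝 0) := by
  have h := (Complex.continuous_re.tendsto 0).comp (tendsto_integral_mul_cexp hab g)
  refine h.congr fun c => ?_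
  have := intervalIntegral.intervalIntegral_re (integrable_cexp_mul hg c)
  simp only [Function.comp_apply]
  refine Eq.trans this.symm (intervalIntegral.integral_congr fun t _ => ?_)
  simp only [← Complex.ofReal_neg, RCLike.re_to_complex, Complex.re_mul_ofReal,
    Complex.exp_ofReal_mul_I_re, Real.cos_neg]
  ring

/-- **Riemann–Lebesgue lemma** for sine integrals over an interval. -/
theorem tendsto_integral_mul_sin {a b : ℝ} (hab : a ≤ b) {g : ℝ → ℝ}
    (hg : IntervalIntegrable g volume a b) :
    Tendsto (fun c : ℝ => ∫ t in a..b, g t * Real.sin (c * t)) atTop (𝓝 0) := by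
  have h := ((Complex.continuous_im.tendsto 0).comp (tendsto_integral_mul_cexp hab g)).neg
  rw [Complex.zero_im, neg_zero] at h
  refine h.congr fun c => ?_
  have := intervalIntegral.intervalIntegral_im (integrable_cexp_mul hg c)
  simp only [Function.comp_apply]
  rw [show Complex.im = (RCLike.im : ℂ → ℝ) from rfl]
  rw [← this, ← intervalIntegral.integral_neg]
  refine intervalIntegral.integral_congr fun t _ => ?_
  simp only [← Complex.ofReal_neg, RCLike.im_to_complex, Complex.im_mul_ofReal,
    Complex.exp_ofReal_mul_I_im, Real.sin_neg]
  ring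

/-! ### The Dirichlet kernel and its derivative -/

/-- The Dirichlet kernel `1 / 2 + ∑_{k=1}^{n-1} cos k u` (for `n ≥ 1`). -/
noncomputable def dirichletSum (n : ℕ) (u : ℝ) : ℝ :=
  ∑ k ∈ Finset.range n, Real.cos (k * u) - 1 / 2

/-- The negated derivative `∑_{k<n} k sin k u` of the Dirichlet kernel. -/
noncomputable def sineSum (n : ℕ) (u : ℝ) : ℝ :=
  ∑ k ∈ Finset.range n, k * Real.sin (k * u)

theorem continuous_dirichletSum (n : ℕ) : Continuous (dirichletSum n) := by
  unfold dirichletSum; fun_prop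

theorem continuous_sineSum (n : ℕ) : Continuous (sineSum n) := by
  unfold sineSum; fun_prop

theorem hasDerivAt_dirichletSum (n : ℕ) (u : ℝ) :
    HasDerivAt (dirichletSum n) (-sineSum n u) u := by
  unfold dirichletSum sineSum
  rw [← Finset.sum_neg_distrib]
  refine HasDerivAt.sub_const _ (HasDerivAt.fun_sum fun k _ => ?_)
  have := ((hasDerivAt_id u).const_mul (k : ℝ)).cos
  simp only [id, mul_one] at this
  convert! this using 1
  ring

/-- A telescoping sum. It starts at `n = 0`, where the definition gives the value `-1 / 2`. -/
theorem two_mul_sin_mul_dirichletSum (n : ℕ) (u : ℝ) :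
    2 * Real.sin (u / 2) * dirichletSum n u = Real.sin ((n - 1 / 2) * u) := by
  induction n with
  | zero =>
    simp only [dirichletSum, Finset.range_zero, Finset.sum_empty, Nat.cast_zero]
    rw [show (0 - 1 / 2) * u = -(u / 2) by ring, Real.sin_neg]
    ring
  | succ n ih =>
    have e : dirichletSum (n + 1) u = dirichletSum n u + Real.cos (n * u) := by
      simp only [dirichletSum, Finset.sum_range_succ]; ring
    rw [e, mul_add, ih]
    push_cast
    rw [show ((n : ℝ) + 1 - 1 / 2) * u = n * u + u / 2 by ring,
      show ((n : ℝ) - 1 / 2) * u = n * u - u / 2 by ring, Real.sin_add, Real.sin_sub]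
    ring

/-- This is the derivative of the preceding identity, by uniqueness of derivatives. -/
theorem two_mul_sin_mul_sineSum (n : ℕ) (u : ℝ) :
    2 * Real.sin (u / 2) * sineSum n u = dirichletSum n u * Real.cos (u / 2) -
      (n - 1 / 2) * Real.cos ((n - 1 / 2) * u) := by
  have h1 : HasDerivAt (fun u => 2 * Real.sin (u / 2) * dirichletSum n u)
      (2 * (Real.cos (u / 2) * (1 / 2)) * dirichletSum n u +
        2 * Real.sin (u / 2) * (-sineSum n u)) u :=
    ((((hasDerivAt_id u).div_const 2).sin).const_mul 2).mul (hasDerivAt_dirichletSum n u)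
  have h2 : HasDerivAt (fun u => Real.sin ((n - 1 / 2) * u))
      (Real.cos ((n - 1 / 2) * u) * ((n - 1 / 2) * 1)) u :=
    ((hasDerivAt_id u).const_mul ((n : ℝ) - 1 / 2)).sin
  simp_rw [two_mul_sin_mul_dirichletSum] at h1
  linarith [h1.unique h2]

theorem abs_dirichletSum_le {n : ℕ} (hn : 1 ≤ n) (u : ℝ) : |dirichletSum n u| ≤ n := by
  obtain ⟨m, rfl⟩ : ∃ m, n = m + 1 := ⟨n - 1, by omega⟩
  rw [dirichletSum, Finset.sum_range_succ']
  have h : |∑ k ∈ Finset.range m, Real.cos ((k + 1 : ℕ) * u)| ≤ m := by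
    refine (Finset.abs_sum_le_sum_abs _ _).trans ?_
    refine (Finset.sum_le_sum fun k _ => Real.abs_cos_le_one _).trans ?_
    simp
  simp only [Nat.cast_zero, zero_mul, Real.cos_zero]
  rw [abs_le] at *
  rw [Nat.cast_succ]
  constructor <;> linarith [h.1, h.2]

theorem abs_sineSum_le (n : ℕ) (u : ℝ) : |sineSum n u| ≤ n * n := by
  refine (Finset.abs_sum_le_sum_abs _ _).trans ?_
  calc _ ≤ ∑ k ∈ Finset.range n, (n : ℝ) := Finset.sum_le_sum fun k hk => by
        rw [abs_mul, Nat.abs_cast]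
        have h1 : (k : ℝ) ≤ n := by exact_mod_cast (Finset.mem_range.1 hk).le
        nlinarith [Real.abs_sin_le_one (k * u), abs_nonneg (Real.sin (k * u))]
    _ = _ := by simp

theorem div_pi_le_sin_half {u : ℝ} (hu : u ∈ Ioc 0 Real.pi) : u / Real.pi ≤ Real.sin (u / 2) := by
  have := Real.mul_le_sin (x := u / 2) (by linarith [hu.1]) (by linarith [hu.2])
  refine le_trans (le_of_eq ?_) this
  field_simp

theorem sin_half_pos {u : ℝ} (hu : u ∈ Ioc 0 Real.pi) : 0 < Real.sin (u / 2) :=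
  (div_pos hu.1 Real.pi_pos).trans_le (div_pi_le_sin_half hu)

theorem dirichletSum_eq {u : ℝ} (hu : u ∈ Ioc 0 Real.pi) (n : ℕ) :
    dirichletSum n u = Real.sin ((n - 1 / 2) * u) / (2 * Real.sin (u / 2)) := by
  have := sin_half_pos hu
  rw [eq_div_iff (by positivity), ← two_mul_sin_mul_dirichletSum]
  ring

theorem abs_dirichletSum_le_div {u : ℝ} (hu : u ∈ Ioc 0 Real.pi) (n : ℕ) :
    |dirichletSum n u| ≤ Real.pi / (2 * u) := by
  have h1 := sin_half_pos hu
  have h2 := div_pi_le_sin_half hu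
  have hu0 := hu.1
  have hpi := Real.pi_pos
  rw [dirichletSum_eq hu, abs_div, abs_of_pos (a := 2 * _) (by positivity),
    div_le_div_iff₀ (by positivity) (by positivity)]
  rw [div_le_iff₀ hpi] at h2
  nlinarith [Real.abs_sin_le_one ((n - 1 / 2) * u), abs_nonneg (Real.sin ((n - 1 / 2) * u))]

theorem abs_sineSum_le_div {u : ℝ} (hu : u ∈ Ioc 0 Real.pi) {n : ℕ} (hn : 1 ≤ n) :
    |sineSum n u| ≤ n * (Real.pi / u) := by
  have h1 := sin_half_pos hu
  have h2 := div_pi_le_sin_half hu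
  have hu0 := hu.1
  have hpi := Real.pi_pos
  have hn' : (1 : ℝ) ≤ n := by exact_mod_cast hn
  have h3 := congrArg abs (two_mul_sin_mul_sineSum n u)
  rw [abs_mul, abs_of_pos (a := 2 * _) (by positivity)] at h3
  have h4 : |dirichletSum n u * Real.cos (u / 2) -
      (n - 1 / 2) * Real.cos ((n - 1 / 2) * u)| ≤ 2 * n := by
    refine (abs_sub _ _).trans ?_
    rw [abs_mul, abs_mul, abs_of_pos (a := (n : ℝ) - 1 / 2) (by linarith)]
    have e1 := mul_le_mul (abs_dirichletSum_le hn u) (Real.abs_cos_le_one (u / 2))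
      (abs_nonneg _) (by positivity)
    have e2 := mul_le_mul_of_nonneg_left (Real.abs_cos_le_one ((n - 1 / 2) * u))
      (show (0 : ℝ) ≤ n - 1 / 2 by linarith)
    linarith
  rw [← h3] at h4
  rw [← mul_div_assoc, le_div_iff₀ hu0]
  rw [div_le_iff₀ hpi] at h2
  have h5 : Real.sin (u / 2) * |sineSum n u| ≤ n := by linarith
  calc |sineSum n u| * u ≤ |sineSum n u| * (Real.sin (u / 2) * Real.pi) := by gcongr
    _ = Real.sin (u / 2) * |sineSum n u| * Real.pi := by ring
    _ ≤ n * Real.pi := by gcongr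

/-- Integration by parts of $\sin(mu)/(2\sin(u/2))$. The remainder is dominated by the derivative of
$-1/(2m\sin(u/2))$, so it is bounded by boundary values. The contributions at $\pi$ cancel, leaving
$1/(m\sin(t/2))$. -/
theorem abs_integral_dirichletSum_le {t : ℝ} (ht : t ∈ Ioc 0 Real.pi) {n : ℕ} (hn : 1 ≤ n) :
    |∫ u in t..Real.pi, dirichletSum n u| ≤ 2 * Real.pi / (n * t) := by
  have hpi := Real.pi_pos
  have ht0 := ht.1
  have hn' : (1 : ℝ) ≤ n := by exact_mod_cast hn
  set m : ℝ := n - 1 / 2 with hm_def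
  have hm : 0 < m := by linarith
  have hmem : ∀ u ∈ Icc t Real.pi, u ∈ Ioc 0 Real.pi := fun u hu => ⟨ht.1.trans_le hu.1, hu.2⟩
  have hsin : ∀ u : ℝ, HasDerivAt (fun u => Real.sin (u / 2)) (Real.cos (u / 2) * (1 / 2)) u :=
    fun u => ((hasDerivAt_id u).div_const 2).sin
  have hcos : ∀ u : ℝ, HasDerivAt (fun u => Real.cos (m * u)) (-Real.sin (m * u) * (m * 1)) u :=
    fun u => ((hasDerivAt_id u).const_mul m).cos
  have hcont : ContinuousOn (fun u => Real.cos (m * u) * Real.cos (u / 2) /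
      (4 * m * Real.sin (u / 2) ^ 2)) (uIcc t Real.pi) := by
    refine ContinuousOn.div (by fun_prop) (by fun_prop) fun u hu => ?_
    rw [uIcc_of_le ht.2] at hu
    have := sin_half_pos (hmem u hu)
    positivity
  have hcont' : ContinuousOn (fun u => Real.cos (u / 2) /
      (4 * m * Real.sin (u / 2) ^ 2)) (uIcc t Real.pi) := by
    refine ContinuousOn.div (by fun_prop) (by fun_prop) fun u hu => ?_
    rw [uIcc_of_le ht.2] at hu
    have := sin_half_pos (hmem u hu)
    positivity
  have hE : ∫ u in t..Real.pi, (dirichletSum n u + Real.cos (m * u) * Real.cos (u / 2) /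
      (4 * m * Real.sin (u / 2) ^ 2)) =
      -(Real.cos (m * Real.pi) / (2 * m * Real.sin (Real.pi / 2))) -
        -(Real.cos (m * t) / (2 * m * Real.sin (t / 2))) := by
    refine intervalIntegral.integral_eq_sub_of_hasDerivAt
      (f := fun u => -(Real.cos (m * u) / (2 * m * Real.sin (u / 2)))) (fun u hu => ?_) ?_
    · rw [uIcc_of_le ht.2] at hu
      have hs := sin_half_pos (hmem u hu)
      have := ((hcos u).fun_div ((hsin u).const_mul (2 * m)) (by positivity)).fun_neg
      convert! this using 1
      rw [dirichletSum_eq (hmem u hu), ← hm_def]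
      field_simp
      ring
    · exact ((continuous_dirichletSum n).intervalIntegrable _ _).add hcont.intervalIntegrable
  have hR : ∫ u in t..Real.pi, Real.cos (u / 2) / (4 * m * Real.sin (u / 2) ^ 2) =
      -(1 / (2 * m * Real.sin (Real.pi / 2))) - -(1 / (2 * m * Real.sin (t / 2))) := by
    refine intervalIntegral.integral_eq_sub_of_hasDerivAt
      (f := fun u => -(1 / (2 * m * Real.sin (u / 2)))) (fun u hu => ?_) hcont'.intervalIntegrable
    rw [uIcc_of_le ht.2] at hu
    have hs := sin_half_pos (hmem u hu)
    have := ((hasDerivAt_const u (1 : ℝ)).fun_div ((hsin u).const_mul (2 * m))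
      (by positivity)).fun_neg
    convert! this using 1
    field_simp
    ring
  have hle : |∫ u in t..Real.pi, Real.cos (m * u) * Real.cos (u / 2) /
      (4 * m * Real.sin (u / 2) ^ 2)| ≤
      ∫ u in t..Real.pi, Real.cos (u / 2) / (4 * m * Real.sin (u / 2) ^ 2) := by
    refine (intervalIntegral.abs_integral_le_integral_abs ht.2).trans ?_
    refine intervalIntegral.integral_mono_on ht.2 hcont.intervalIntegrable.abs
      hcont'.intervalIntegrable fun u hu => ?_
    have hs := sin_half_pos (hmem u hu)
    have hc : 0 ≤ Real.cos (u / 2) := Real.cos_nonneg_of_mem_Icc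
      ⟨by linarith [(hmem u hu).1], by linarith [hu.2]⟩
    rw [abs_div, abs_mul, abs_of_nonneg hc, abs_of_pos (a := 4 * m * _) (by positivity)]
    gcongr
    exact mul_le_of_le_one_left hc (Real.abs_cos_le_one _)
  rw [intervalIntegral.integral_add ((continuous_dirichletSum n).intervalIntegrable _ _)
    hcont.intervalIntegrable, Real.sin_pi_div_two, mul_one] at hE
  rw [hR, Real.sin_pi_div_two, mul_one] at hle
  have hs := sin_half_pos ht
  have h1 : |Real.cos (m * Real.pi) / (2 * m)| ≤ 1 / (2 * m) := by
    rw [abs_div, abs_of_pos (a := 2 * m) (by positivity)]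
    gcongr
    exact Real.abs_cos_le_one _
  have h2 : |Real.cos (m * t) / (2 * m * Real.sin (t / 2))| ≤ 1 / (2 * m * Real.sin (t / 2)) := by
    rw [abs_div, abs_of_pos (a := 2 * m * _) (by positivity)]
    gcongr
    exact Real.abs_cos_le_one _
  have h3 : 2 * (1 / (2 * m * Real.sin (t / 2))) ≤ 2 * Real.pi / (n * t) := by
    have h4 := div_pi_le_sin_half ht
    have h5 : (n : ℝ) / 2 ≤ m := by linarith
    rw [div_le_iff₀ hpi] at h4
    rw [mul_one_div, div_le_div_iff₀ (by positivity) (by positivity)]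
    calc 2 * (n * t) ≤ 2 * (2 * m * (Real.sin (t / 2) * Real.pi)) := by gcongr; linarith
      _ = _ := by ring
  rw [abs_le] at *
  constructor <;> linarith [h1.1, h1.2, h2.1, h2.2, hle.1, hle.2]

theorem tendsto_natCast_sub_half_atTop : Tendsto (fun n : ℕ => (n : ℝ) - 1 / 2) atTop atTop :=
  tendsto_atTop_add_const_right _ _ tendsto_natCast_atTop_atTop

/-- The primitive is based at `π` because the one based at `0` tends to `π / 2` at each fixed `t` in
`(0, π]` and does not decay. -/
theorem isHarmonicKernel_dirichletSum :
    IsHarmonicKernel dirichletSum (fun n t => ∫ u in Real.pi..t, dirichletSum n u)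
      (2 * Real.pi) where
  continuous := continuous_dirichletSum
  hasDerivAt n _ t _ := intervalIntegral.integral_hasDerivAt_right
    ((continuous_dirichletSum n).intervalIntegrable _ _)
    ((continuous_dirichletSum n).stronglyMeasurableAtFilter _ _)
    (continuous_dirichletSum n).continuousAt
  abs_le_mul n hn t _ := by
    refine (abs_dirichletSum_le hn t).trans ?_
    nlinarith [Real.two_le_pi, n.cast_nonneg (α := ℝ)]
  abs_le_div n _ t ht := by
    refine (abs_dirichletSum_le_div ht n).trans ?_
    have := ht.1
    have := Real.pi_pos
    gcongr <;> linarith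
  abs_primitive_le n hn t ht := by
    rw [intervalIntegral.integral_symm, abs_neg]
    exact abs_integral_dirichletSum_le ht hn
  tendsto_integral_zero δ hδ g hg := by
    have hmem : ∀ u ∈ uIcc δ Real.pi, u ∈ Ioc 0 Real.pi := fun u hu => by
      rw [uIcc_of_le hδ.2.le] at hu
      exact ⟨hδ.1.trans_le hu.1, hu.2⟩
    have h1 : IntervalIntegrable (fun u => g u * (1 / (2 * Real.sin (u / 2)))) volume δ
        Real.pi := hg.mul_continuousOn <| by
      refine ContinuousOn.div (by fun_prop) (by fun_prop) fun u hu => ?_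
      have := sin_half_pos (hmem u hu)
      positivity
    refine ((tendsto_integral_mul_sin hδ.2.le h1).comp tendsto_natCast_sub_half_atTop).congr
      fun n => ?_
    refine intervalIntegral.integral_congr fun u hu => ?_
    simp only [dirichletSum_eq (hmem u hu)]
    ring

/-- Away from `0` the kernel does not become small, but its leading part is a cosine of frequency `n
- 1 / 2` with a fixed continuous amplitude, so Riemann–Lebesgue applies. -/
theorem isHarmonicKernel_sineSum :
    IsHarmonicKernel (fun n u => sineSum n u / n) (fun n u => -dirichletSum n u / n)
      (2 * Real.pi) where
  continuous n := (continuous_sineSum n).div_const _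
  hasDerivAt n _ t _ := by
    simpa using ((hasDerivAt_dirichletSum n t).fun_neg).div_const (n : ℝ)
  abs_le_mul n hn t _ := by
    have hn' : (1 : ℝ) ≤ n := by exact_mod_cast hn
    rw [abs_div, Nat.abs_cast, div_le_iff₀ (by positivity)]
    refine (abs_sineSum_le n t).trans ?_
    nlinarith [Real.two_le_pi]
  abs_le_div n hn t ht := by
    have hn' : (1 : ℝ) ≤ n := by exact_mod_cast hn
    have := ht.1
    have := Real.pi_pos
    rw [abs_div, Nat.abs_cast, div_le_iff₀ (by positivity), mul_comm]
    refine (abs_sineSum_le_div ht hn).trans ?_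
    gcongr
    linarith
  abs_primitive_le n hn t ht := by
    have hn' : (1 : ℝ) ≤ n := by exact_mod_cast hn
    have := ht.1
    have hpi := Real.pi_pos
    rw [abs_div, Nat.abs_cast, abs_neg, div_le_iff₀ (by positivity)]
    refine (abs_dirichletSum_le_div ht n).trans ?_
    rw [div_mul_eq_mul_div, div_le_div_iff₀ (by positivity) (by positivity)]
    have : 0 < Real.pi * n * t := by positivity
    nlinarith
  tendsto_integral_zero δ hδ g hg := by
    have hmem : ∀ u ∈ uIcc δ Real.pi, u ∈ Ioc 0 Real.pi := fun u hu => by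
      rw [uIcc_of_le hδ.2.le] at hu
      exact ⟨hδ.1.trans_le hu.1, hu.2⟩
    have h1 : IntervalIntegrable (fun u => g u * (1 / (2 * Real.sin (u / 2)))) volume δ
        Real.pi := hg.mul_continuousOn <| by
      refine ContinuousOn.div (by fun_prop) (by fun_prop) fun u hu => ?_
      have := sin_half_pos (hmem u hu)
      positivity
    have h2 : IntervalIntegrable (fun u => g u * (Real.cos (u / 2) /
        (4 * Real.sin (u / 2) ^ 2))) volume δ Real.pi := hg.mul_continuousOn <| by
      refine ContinuousOn.div (by fun_prop) (by fun_prop) fun u hu => ?_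
      have := sin_half_pos (hmem u hu)
      positivity
    have l1 := (tendsto_integral_mul_cos hδ.2.le h1).comp tendsto_natCast_sub_half_atTop
    have l2 := (tendsto_integral_mul_sin hδ.2.le h2).comp tendsto_natCast_sub_half_atTop
    have l3 : Tendsto (fun n : ℕ => 1 / (n : ℝ)) atTop (𝓝 0) := tendsto_one_div_atTop_nhds_zero_nat
    have l4 : Tendsto (fun n : ℕ => ((n : ℝ) - 1 / 2) * (1 / (n : ℝ))) atTop (𝓝 1) := by
      have : Tendsto (fun n : ℕ => 1 - 1 / 2 * (1 / (n : ℝ))) atTop (𝓝 (1 - 1 / 2 * 0)) :=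
        (l3.const_mul _).const_sub _
      rw [mul_zero, sub_zero] at this
      refine this.congr' ?_
      filter_upwards [eventually_ge_atTop 1] with n hn
      have hn' : (0 : ℝ) < n := by exact_mod_cast hn
      field_simp
    have l5 := (l3.mul l2).sub (l4.mul l1)
    simp only [mul_zero, sub_zero] at l5
    refine l5.congr fun n => ?_
    simp only [Function.comp_apply]
    rw [← intervalIntegral.integral_const_mul, ← intervalIntegral.integral_const_mul,
      ← intervalIntegral.integral_sub]
    · refine intervalIntegral.integral_congr fun u hu => ?_
      have hs := sin_half_pos (hmem u hu)
      have h3 : sineSum n u = (dirichletSum n u * Real.cos (u / 2) -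
          (n - 1 / 2) * Real.cos ((n - 1 / 2) * u)) / (2 * Real.sin (u / 2)) := by
        rw [eq_div_iff (by positivity), ← two_mul_sin_mul_sineSum]
        ring
      simp only [h3, dirichletSum_eq (hmem u hu)]
      field_simp
      ring
    · exact (h2.mul_continuousOn (by fun_prop)).const_mul _
    · exact (h1.mul_continuousOn (by fun_prop)).const_mul _

theorem integral_dirichletSum {n : ℕ} (hn : 1 ≤ n) :
    ∫ u in (0 : ℝ)..Real.pi, dirichletSum n u = Real.pi / 2 := by
  obtain ⟨m, rfl⟩ : ∃ m, n = m + 1 := ⟨n - 1, by omega⟩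
  simp only [dirichletSum]
  rw [intervalIntegral.integral_sub (Continuous.intervalIntegrable (by fun_prop) _ _)
    intervalIntegrable_const, intervalIntegral.integral_finsetSum
    fun k _ => Continuous.intervalIntegrable (by fun_prop) _ _, Finset.sum_range_succ',
    Finset.sum_eq_zero]
  · simp
    ring
  · intro k _
    rw [intervalIntegral.integral_comp_mul_left _ (by positivity)]
    simp [-Nat.cast_add, Real.sin_nat_mul_pi]

/-- The integral telescopes to a difference of Dirichlet kernel values: `n - 1 / 2` at `0`, and at
most `1 / 2` in size at `π`. -/
theorem tendsto_integral_sineSum :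
    Tendsto (fun n : ℕ => ∫ u in (0 : ℝ)..Real.pi, sineSum n u / n) atTop (𝓝 1) := by
  have hpi := Real.pi_pos
  have h1 : ∀ n : ℕ, ∫ u in (0 : ℝ)..Real.pi, sineSum n u =
      (n - 1 / 2) - dirichletSum n Real.pi := fun n => by
    have := intervalIntegral.integral_eq_sub_of_hasDerivAt (a := 0) (b := Real.pi)
      (fun u _ => (hasDerivAt_dirichletSum n u).fun_neg)
      ((continuous_sineSum n).neg.neg.intervalIntegrable _ _)
    simp only [neg_neg] at this
    rw [this]
    have h0 : dirichletSum n 0 = n - 1 / 2 := by simp [dirichletSum]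
    rw [h0]
    ring
  rw [← tendsto_sub_nhds_zero_iff]
  refine squeeze_zero_norm' (a := fun n : ℕ => 1 / (n : ℝ)) ?_ tendsto_one_div_atTop_nhds_zero_nat
  filter_upwards [eventually_ge_atTop 1] with n hn
  have hn' : (0 : ℝ) < n := by exact_mod_cast hn
  rw [intervalIntegral.integral_div, h1, Real.norm_eq_abs]
  have h2 := abs_dirichletSum_le_div (u := Real.pi) ⟨hpi, le_rfl⟩ n
  rw [show Real.pi / (2 * Real.pi) = 1 / 2 by field_simp] at h2
  rw [show ((n : ℝ) - 1 / 2 - dirichletSum n Real.pi) / n - 1 =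
    (-(1 / 2) - dirichletSum n Real.pi) / n by field_simp; ring, abs_div, Nat.abs_cast]
  gcongr
  rw [abs_le] at *
  constructor <;> linarith [h2.1, h2.2]

/-! ### Reduction to harmonic variation and transfer to the circle -/

/-- Termwise $x/i\le x^2+1/i^2$, and $\sum 1/i^2$ converges. -/
theorem WienerV.hbv {a b : ℝ} {f : ℝ → ℝ} (h : WienerV 2 a b f) : HBV a b f := by
  obtain ⟨C, hC⟩ := h
  have hs : Summable fun i : ℕ => 1 / ((i : ℝ) + 1) ^ 2 := by
    have := (summable_nat_add_iff (f := fun i : ℕ => 1 / (i : ℝ) ^ 2) 1).2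
      (Real.summable_one_div_nat_pow.2 one_lt_two)
    simpa using this
  refine ⟨C + ∑' i : ℕ, 1 / ((i : ℝ) + 1) ^ 2, ?_⟩
  rintro _ ⟨N, u, v, huv, rfl⟩
  have h1 : ∑ i : Fin N, |f (v i) - f (u i)| ^ (2 : ℝ) ≤ C := hC ⟨N, u, v, huv, rfl⟩
  have h2 : ∑ i : Fin N, 1 / (((i : ℕ) : ℝ) + 1) ^ 2 ≤ ∑' i : ℕ, 1 / ((i : ℝ) + 1) ^ 2 := by
    rw [Fin.sum_univ_eq_sum_range (fun i => 1 / ((i : ℝ) + 1) ^ 2) N]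
    exact hs.sum_le_tsum _ fun i _ => by positivity
  refine le_trans ?_ (add_le_add h1 h2)
  rw [← Finset.sum_add_distrib]
  refine Finset.sum_le_sum fun i _ => ?_
  rw [Real.rpow_two]
  push_cast
  have h3 : 0 ≤ 1 / (((i : ℕ) : ℝ) + 1) := by positivity
  rw [← one_div_pow, div_eq_mul_one_div]
  nlinarith [abs_nonneg (f (v i) - f (u i)),
    sq_nonneg (|f (v i) - f (u i)| - 1 / (((i : ℕ) : ℝ) + 1))]

theorem le_of_strictMono_fin {N : ℕ} {e : Fin N → ℕ} (he : StrictMono e) (i : Fin N) :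
    (i : ℕ) ≤ e i := by
  obtain ⟨k, hk⟩ := i
  induction k with
  | zero => exact Nat.zero_le _
  | succ k ih =>
    exact (ih (by omega)).trans_lt (he (a := ⟨k, by omega⟩) (b := ⟨k + 1, hk⟩) (by simp))

/-- Degenerate intervals contribute nothing, and renumbering the others consecutively in increasing
order of index only increases the weights. -/
theorem HBV.harmonicVarLE {a b : ℝ} {f : ℝ → ℝ} (h : HBV a b f) :
    ∃ C, HarmonicVarLE f (Icc a b) C := by
  obtain ⟨C, hC⟩ := h
  refine ⟨C, fun s u v h1 h2 => ?_⟩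
  set s' := s.filter fun i => u i ≠ v i
  set e := s'.orderEmbOfFin rfl
  have hmem : ∀ i, e i ∈ s ∧ u (e i) ≠ v (e i) := fun i =>
    Finset.mem_filter.1 (s'.orderEmbOfFin_mem rfl i)
  have hsum : ∑ i ∈ s, |f (v i) - f (u i)| / ((i : ℝ) + 1) =
      ∑ i, |f (v (e i)) - f (u (e i))| / ((e i : ℝ) + 1) := by
    have hs' : ∑ i ∈ s', |f (v i) - f (u i)| / ((i : ℝ) + 1) =
        ∑ i ∈ s, |f (v i) - f (u i)| / ((i : ℝ) + 1) := by
      refine Finset.sum_filter_of_ne fun i _ hne heq => ?_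
      rw [heq] at hne
      simp at hne
    rw [← hs']
    conv_lhs => rw [← Finset.map_orderEmbOfFin_univ s' rfl]
    rw [Finset.sum_map]
    rfl
  rw [hsum]
  refine le_trans ?_ (hC ⟨_, fun i => u (e i), fun i => v (e i), ⟨fun i => ?_, fun i j hij => ?_⟩,
    rfl⟩)
  · refine Finset.sum_le_sum fun i _ => ?_
    have : ((i : ℕ) : ℝ) ≤ e i := by exact_mod_cast le_of_strictMono_fin e.strictMono i
    push_cast
    gcongr
  · obtain ⟨h3, h4⟩ := hmem i
    obtain ⟨h5, h6, h7⟩ := h1 _ h3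
    exact ⟨h6.1, lt_of_le_of_ne h5 h4, h7.2⟩
  · rw [Ioo_disjoint_Ioo]
    rcases h2 _ (hmem i).1 _ (hmem j).1 (e.injective.ne hij) with h | h
    · exact (min_le_left _ _).trans (h.trans (le_max_right _ _))
    · exact (min_le_right _ _).trans (h.trans (le_max_left _ _))

/-- The composition with the cosine is of bounded harmonic variation on `[-π, 2π]`. -/
theorem HarmonicVarLE.comp_cos {f : ℝ → ℝ} {C : ℝ} (h : HarmonicVarLE f (Icc (-1) 1) C) :
    HarmonicVarLE (fun θ => f (Real.cos θ)) (Icc (-Real.pi) (2 * Real.pi)) (C + C + C) := by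
  -- The cosine is monotone on each of three half-periods, which together contain every `θ ± u` with
  -- `θ` and `u` in `[0, π]`.
  have h1 : HarmonicVarLE (fun θ => f (Real.cos θ)) (Icc 0 Real.pi) C :=
    h.comp_antitoneOn Real.strictAntiOn_cos.antitoneOn fun t _ => Real.cos_mem_Icc t
  have h2 : HarmonicVarLE (fun θ => f (Real.cos θ)) (Icc (-Real.pi) 0) C := by
    have := h1.comp_antitoneOn (g := fun t => -t) (T := Icc (-Real.pi) 0)
      (fun s _ t _ hst => neg_le_neg hst)
      (fun t ht => ⟨by linarith [ht.2], by linarith [ht.1]⟩)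
    simpa only [Real.cos_neg] using this
  have h3 : HarmonicVarLE (fun θ => f (Real.cos θ)) (Icc Real.pi (2 * Real.pi)) C := by
    have := h1.comp_antitoneOn (g := fun t => 2 * Real.pi - t) (T := Icc Real.pi (2 * Real.pi))
      (fun s _ t _ hst => sub_le_sub_left hst _)
      (fun t ht => ⟨by linarith [ht.2], by linarith [ht.1]⟩)
    simpa only [Real.cos_two_pi_sub] using this
  exact (h2.union h1).union h3

/-! ### From arithmetic means to tails -/

/-- If the arithmetic means of `k ^ 2 * d k` tend to `L`, then `n` times the tails of the series
`∑ d k` tend to `L`. -/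
theorem tendsto_mul_tail_of_cesaro {d T : ℕ → ℝ} {L : ℝ}
    (hT : ∀ n, Tendsto (fun N => ∑ k ∈ Finset.Ico n N, d k) atTop (𝓝 (T n)))
    (hL : Tendsto (fun n : ℕ => (n : ℝ)⁻¹ * ∑ k ∈ Finset.range n, (k : ℝ) ^ 2 * d k) atTop
      (𝓝 L)) :
    Tendsto (fun n : ℕ => (n : ℝ) * T n) atTop (𝓝 L) := by
  set s : ℕ → ℝ := fun n => ∑ k ∈ Finset.range n, (k : ℝ) ^ 2 * d k with hs
  have hTsub : ∀ n, T n = d n + T (n + 1) := fun n => by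
    refine tendsto_nhds_unique (hT n) (((hT (n + 1)).const_add (d n)).congr' ?_)
    filter_upwards [eventually_gt_atTop n] with N hN
    rw [Finset.sum_eq_sum_Ico_succ_bot hN]
  have hT0 : Tendsto T atTop (𝓝 0) := by
    have h1 : ∀ n, T n = T 0 - ∑ k ∈ Finset.range n, d k := fun n => by
      induction n with
      | zero => simp
      | succ n ih => rw [Finset.sum_range_succ]; linarith [hTsub n]
    have h2 : Tendsto (fun N => ∑ k ∈ Finset.range N, d k) atTop (𝓝 (T 0)) := by
      simpa using hT 0
    have := h2.const_sub (T 0)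
    rw [sub_self] at this
    exact this.congr fun n => (h1 n).symm
  have hinv : Tendsto (fun n : ℕ => ((n : ℝ))⁻¹) atTop (𝓝 0) :=
    tendsto_inv_atTop_nhds_zero_nat
  -- Summation by parts: adding `s n / n ^ 2` to the tail gives
  -- $Y_n-Y_{n+1}=s_{n+1}(n^{-2}-(n+1)^{-2})$. This is $\tau_n(1/n-1/(n+1))$ with $\tau_n\to2L$.
  -- Telescoping yields $nY_n\to2L$, and subtracting $s_n/n\to L$ leaves $L$.
  set Y : ℕ → ℝ := fun n => T n + (n : ℝ)⁻¹ * ((n : ℝ)⁻¹ * s n) with hY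
  have hY0 : Tendsto Y atTop (𝓝 0) := by
    have := hT0.add (hinv.mul hL)
    simpa using this
  set τ : ℕ → ℝ := fun n => (2 + (n : ℝ)⁻¹) * (((n + 1 : ℕ) : ℝ)⁻¹ * s (n + 1)) with hτ
  have hτL : Tendsto τ atTop (𝓝 (2 * L)) := by
    have := (hinv.const_add 2).mul ((tendsto_add_atTop_iff_nat 1).2 hL)
    rwa [add_zero] at this
  have hstep : ∀ n : ℕ, 1 ≤ n → Y n - Y (n + 1) = τ n * ((n : ℝ)⁻¹ - ((n + 1 : ℕ) : ℝ)⁻¹) := by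
    intro n hn
    have hn' : (0 : ℝ) < n := by exact_mod_cast hn
    have hsn : s (n + 1) = s n + (n : ℝ) ^ 2 * d n := Finset.sum_range_succ _ _
    simp only [hY, hτ, hTsub n, hsn]
    push_cast
    field_simp
    ring
  have hnY : Tendsto (fun n : ℕ => (n : ℝ) * Y n) atTop (𝓝 (2 * L)) := by
    rw [Metric.tendsto_atTop]
    intro ε hε
    obtain ⟨M, hM⟩ := Metric.tendsto_atTop.1 hτL (ε / 2) (half_pos hε)
    refine ⟨max M 1, fun n hn => ?_⟩
    have hnM : M ≤ n := (le_max_left _ _).trans hn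
    have hn1 : 1 ≤ n := (le_max_right _ _).trans hn
    have hn' : (0 : ℝ) < n := by exact_mod_cast hn1
    have hfin : ∀ m : ℕ, |Y n - Y (n + m) - 2 * L * ((n : ℝ)⁻¹ - ((n + m : ℕ) : ℝ)⁻¹)| ≤
        ε / 2 * ((n : ℝ)⁻¹ - ((n + m : ℕ) : ℝ)⁻¹) := by
      intro m
      induction m with
      | zero => simp
      | succ m ih =>
        have h1 := hstep (n + m) (by omega)
        have h2 := (hM (n + m) (by omega)).le
        rw [Real.dist_eq] at h2
        have h3 : 0 ≤ ((n + m : ℕ) : ℝ)⁻¹ - ((n + m + 1 : ℕ) : ℝ)⁻¹ := by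
          rw [sub_nonneg]
          refine inv_anti₀ (by exact_mod_cast (by omega : 0 < n + m)) ?_
          exact_mod_cast Nat.le_succ _
        have h4 := mul_le_mul_of_nonneg_right h2 h3
        rw [← abs_of_nonneg h3, ← abs_mul, abs_of_nonneg h3, sub_mul, ← h1] at h4
        rw [← add_assoc]
        rw [abs_le] at *
        constructor <;> linarith [h4.1, h4.2, ih.1, ih.2]
    have hlim : |Y n - 0 - 2 * L * ((n : ℝ)⁻¹ - 0)| ≤ ε / 2 * ((n : ℝ)⁻¹ - 0) := by
      have e1 : Tendsto (fun m => Y (n + m)) atTop (𝓝 0) := by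
        simp_rw [add_comm n]; exact (tendsto_add_atTop_iff_nat n).2 hY0
      have e2 : Tendsto (fun m => ((n + m : ℕ) : ℝ)⁻¹) atTop (𝓝 0) := by
        simp_rw [add_comm n]
        exact (tendsto_add_atTop_iff_nat (f := fun m : ℕ => ((m : ℕ) : ℝ)⁻¹) n).2 hinv
      exact le_of_tendsto_of_tendsto'
        (((e1.const_sub (Y n)).sub ((e2.const_sub _).const_mul _)).abs)
        ((e2.const_sub _).const_mul _) hfin
    rw [sub_zero, sub_zero] at hlim
    rw [Real.dist_eq]
    have h5 : (n : ℝ) * Y n - 2 * L = n * (Y n - 2 * L * (n : ℝ)⁻¹) := by field_simp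
    rw [h5, abs_mul, Nat.abs_cast]
    calc _ ≤ (n : ℝ) * (ε / 2 * (n : ℝ)⁻¹) := by gcongr
      _ = ε / 2 := by field_simp
      _ < ε := half_lt_self hε
  have := hnY.sub hL
  rw [two_mul, add_sub_cancel_right] at this
  refine this.congr' ?_
  filter_upwards [eventually_ge_atTop 1] with n hn
  have hn' : (0 : ℝ) < n := by exact_mod_cast hn
  simp only [hY]
  field_simp
  ring

/-! ### Partial sums as convolutions -/

/-- Convolution on half a period of an even periodic function against a symmetrized kernel. -/
theorem integral_mul_sub_add_eq {φ p : ℝ → ℝ} (hφi : ∀ a b, IntervalIntegrable φ volume a b)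
    (hφe : ∀ t, φ (-t) = φ t) (hφp : Function.Periodic φ (2 * Real.pi)) (hp : Continuous p)
    (hpp : Function.Periodic p (2 * Real.pi)) (θ : ℝ) :
    ∫ t in (0 : ℝ)..Real.pi, φ t * (p (θ - t) + p (θ + t)) =
      ∫ u in (0 : ℝ)..Real.pi, (φ (θ - u) * p u + φ (θ + u) * p (-u)) := by
  have i1 : ∀ a b, IntervalIntegrable (fun t => φ t * p (θ - t)) volume a b := fun a b =>
    (hφi a b).mul_continuousOn (by fun_prop)
  have i2 : ∀ a b, IntervalIntegrable (fun t => φ t * p (θ + t)) volume a b := fun a b =>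
    (hφi a b).mul_continuousOn (by fun_prop)
  have i3 : ∀ a b, IntervalIntegrable (fun u => φ (θ - u) * p u) volume a b := fun a b => by
    have := (i1 (θ - a) (θ - b)).comp_sub_left θ
    simpa using this
  have i4 : ∀ a b, IntervalIntegrable (fun u => φ (θ + u) * p (-u)) volume a b := fun a b => by
    have := (i1 (θ + a) (θ + b)).comp_add_left θ
    simpa using this
  have e1 : ∫ t in (0 : ℝ)..Real.pi, φ t * p (θ + t) =
      ∫ t in (-Real.pi)..0, φ t * p (θ - t) := by
    have := intervalIntegral.integral_comp_neg (a := 0) (b := Real.pi)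
      (fun t => φ t * p (θ - t))
    simpa [hφe] using this
  have e2 : ∫ u in (0 : ℝ)..Real.pi, φ (θ + u) * p (-u) =
      ∫ u in (-Real.pi)..0, φ (θ - u) * p u := by
    have := intervalIntegral.integral_comp_neg (a := 0) (b := Real.pi)
      (fun u => φ (θ - u) * p u)
    simpa using this
  have hper : Function.Periodic (fun t => φ t * p (θ - t)) (2 * Real.pi) := fun t => by
    simp only [hφp t]
    rw [← sub_sub, hpp.sub_eq]
  -- Evenness of `φ` has unfolded the left side to an integral over a full period. Periodicity now
  -- moves that period to the one produced by the substitution `u = θ - t`.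
  have e3 := hper.intervalIntegral_add_eq (-Real.pi) (θ - Real.pi)
  have e4 := intervalIntegral.integral_comp_sub_left (a := -Real.pi) (b := Real.pi)
    (fun t => φ t * p (θ - t)) θ
  simp only [sub_sub_cancel, sub_neg_eq_add] at e4
  simp_rw [mul_add]
  rw [intervalIntegral.integral_add (i1 _ _) (i2 _ _),
    intervalIntegral.integral_add (i3 _ _) (i4 _ _), e1, e2, add_comm,
    intervalIntegral.integral_add_adjacent_intervals (i1 _ _) (i1 _ _), add_comm (∫ u in _.._, _),
    intervalIntegral.integral_add_adjacent_intervals (i3 _ _) (i3 _ _), e4]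
  convert! e3 using 2 <;> ring

theorem chebyshevP_eval_cos (k : ℕ) (θ : ℝ) : (chebyshevP k).eval (Real.cos θ) =
    (if k = 0 then √(1 / Real.pi) else √(2 / Real.pi)) * Real.cos (k * θ) := by
  simp [chebyshevP, Polynomial.Chebyshev.T_real_cos]

theorem chebyshev_norm_sq (k : ℕ) :
    (if k = 0 then √(1 / Real.pi) else √(2 / Real.pi)) *
      (if k = 0 then √(1 / Real.pi) else √(2 / Real.pi)) =
      if k = 0 then 1 / Real.pi else 2 / Real.pi := by
  have := Real.pi_pos
  split_ifs <;> exact Real.mul_self_sqrt (by positivity)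

theorem chebyshevCoeff_eq (f : ℝ → ℝ) (k : ℕ) : chebyshevCoeff f k =
    (if k = 0 then √(1 / Real.pi) else √(2 / Real.pi)) *
      ∫ t in (0 : ℝ)..Real.pi, f (Real.cos t) * Real.cos (k * t) := by
  have h1 : chebyshevCoeff f k = ∫ t in (-1 : ℝ)..1,
      f t * (chebyshevP k).eval t * √(1 - t ^ 2)⁻¹ := by
    refine intervalIntegral.integral_congr fun t ht => ?_
    rw [uIcc_of_le (by norm_num)] at ht
    simp only [chebyshevWeight_eq ht]
  rw [h1, ← Polynomial.Chebyshev.integral_measureT,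
    Polynomial.Chebyshev.integral_measureT_eq_integral_cos, ← intervalIntegral.integral_const_mul]
  refine intervalIntegral.integral_congr fun t _ => ?_
  simp only [chebyshevP_eval_cos]
  ring

theorem periodic_dirichletSum (n : ℕ) : Function.Periodic (dirichletSum n) (2 * Real.pi) := by
  intro u
  simp only [dirichletSum]
  congr 1
  refine Finset.sum_congr rfl fun k _ => ?_
  rw [mul_add]
  exact Real.cos_add_nat_mul_two_pi _ _

theorem dirichletSum_neg (n : ℕ) (u : ℝ) : dirichletSum n (-u) = dirichletSum n u := by
  simp [dirichletSum]

theorem periodic_sineSum (n : ℕ) : Function.Periodic (sineSum n) (2 * Real.pi) := by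
  intro u
  simp only [sineSum]
  refine Finset.sum_congr rfl fun k _ => ?_
  rw [mul_add, Real.sin_add_nat_mul_two_pi]

theorem sineSum_neg (n : ℕ) (u : ℝ) : sineSum n (-u) = -sineSum n u := by
  simp [sineSum]

/-- Product-to-sum formula. The halved weight at `k = 0` matches the constant term `1 / 2` of the
Dirichlet kernel. -/
theorem sum_cos_mul_cos {n : ℕ} (hn : 1 ≤ n) (t θ : ℝ) :
    ∑ k ∈ Finset.range n, (if k = 0 then 1 / Real.pi else 2 / Real.pi) *
      (Real.cos (k * t) * Real.cos (k * θ)) =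
      1 / Real.pi * (dirichletSum n (θ - t) + dirichletSum n (θ + t)) := by
  obtain ⟨m, rfl⟩ : ∃ m, n = m + 1 := ⟨n - 1, by omega⟩
  simp only [dirichletSum, Finset.sum_range_succ', Nat.cast_zero, zero_mul, Real.cos_zero, if_true,
    Nat.succ_ne_zero, if_false]
  have : ∑ k ∈ Finset.range m, 2 / Real.pi *
      (Real.cos ((k + 1 : ℕ) * t) * Real.cos ((k + 1 : ℕ) * θ)) =
      1 / Real.pi * (∑ k ∈ Finset.range m, Real.cos ((k + 1 : ℕ) * (θ - t)) +
        ∑ k ∈ Finset.range m, Real.cos ((k + 1 : ℕ) * (θ + t))) := by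
    rw [← Finset.sum_add_distrib, Finset.mul_sum]
    refine Finset.sum_congr rfl fun k _ => ?_
    rw [mul_sub, mul_add ((k + 1 : ℕ) : ℝ), Real.cos_sub, Real.cos_add]
    ring
  rw [this]
  ring

theorem sum_mul_cos_mul_sin (n : ℕ) (t θ : ℝ) :
    ∑ k ∈ Finset.range n, (k : ℝ) * (Real.cos (k * t) * Real.sin (k * θ)) =
      1 / 2 * (sineSum n (θ - t) + sineSum n (θ + t)) := by
  simp only [sineSum]
  rw [← Finset.sum_add_distrib, Finset.mul_sum]
  refine Finset.sum_congr rfl fun k _ => ?_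
  rw [mul_sub, mul_add (k : ℝ), Real.sin_sub, Real.sin_add]
  ring

theorem HarmonicVarLE.intervalIntegrable_comp_cos {f : ℝ → ℝ} {C : ℝ}
    (h : HarmonicVarLE f (Icc (-1) 1) C) (a b : ℝ) :
    IntervalIntegrable (fun θ => f (Real.cos θ)) volume a b := by
  have hpi := Real.pi_pos
  have h1 := (h.comp_cos.mono (T := Icc (-Real.pi) (-Real.pi + 2 * Real.pi))
    (Icc_subset_Icc_right (by linarith))).intervalIntegrable (by linarith)
  refine Function.Periodic.intervalIntegrable (T := 2 * Real.pi) (fun θ => ?_) (by positivity) h1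
    a b
  simp only [Real.cos_add_two_pi]

theorem HarmonicVarLE.intervalIntegrable_comp_cos_sub {f : ℝ → ℝ} {C : ℝ}
    (h : HarmonicVarLE f (Icc (-1) 1) C) (θ a b : ℝ) :
    IntervalIntegrable (fun u => f (Real.cos (θ - u))) volume a b := by
  have := (h.intervalIntegrable_comp_cos (θ - a) (θ - b)).comp_sub_left θ
  simpa using this

theorem HarmonicVarLE.intervalIntegrable_comp_cos_add {f : ℝ → ℝ} {C : ℝ}
    (h : HarmonicVarLE f (Icc (-1) 1) C) (θ a b : ℝ) :
    IntervalIntegrable (fun u => f (Real.cos (θ + u))) volume a b := by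
  have := (h.intervalIntegrable_comp_cos (θ + a) (θ + b)).comp_add_left θ
  simpa using this

theorem integral_cos_mul_sum {f : ℝ → ℝ} (hfi : IntervalIntegrable (fun θ => f (Real.cos θ)) volume
    0 Real.pi) (s : Finset ℕ) (w : ℕ → ℝ) :
    ∑ k ∈ s, w k * ∫ t in (0 : ℝ)..Real.pi, f (Real.cos t) * Real.cos (k * t) =
      ∫ t in (0 : ℝ)..Real.pi, f (Real.cos t) * ∑ k ∈ s, w k * Real.cos (k * t) := by
  simp_rw [← intervalIntegral.integral_const_mul]
  rw [← intervalIntegral.integral_finsetSum fun k _ =>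
    (hfi.mul_continuousOn (by fun_prop)).const_mul _]
  refine intervalIntegral.integral_congr fun t _ => ?_
  simp only [Finset.mul_sum]
  exact Finset.sum_congr rfl fun k _ => by ring

theorem HarmonicVarLE.chebyshevSection_cos_eq {f : ℝ → ℝ} {C : ℝ}
    (h : HarmonicVarLE f (Icc (-1) 1) C) {n : ℕ} (hn : 1 ≤ n) (θ : ℝ) :
    chebyshevSection f 0 n (Real.cos θ) = 1 / Real.pi *
      ((∫ u in (0 : ℝ)..Real.pi, f (Real.cos (θ - u)) * dirichletSum n u) +
        ∫ u in (0 : ℝ)..Real.pi, f (Real.cos (θ + u)) * dirichletSum n u) := by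
  have hfi := h.intervalIntegrable_comp_cos
  have h1 : chebyshevSection f 0 n (Real.cos θ) = ∑ k ∈ Finset.range n,
      ((if k = 0 then 1 / Real.pi else 2 / Real.pi) * Real.cos (k * θ)) *
      ∫ t in (0 : ℝ)..Real.pi, f (Real.cos t) * Real.cos (k * t) := by
    rw [chebyshevSection, ← Finset.range_eq_Ico]
    refine Finset.sum_congr rfl fun k _ => ?_
    rw [chebyshevCoeff_eq, chebyshevP_eval_cos, ← chebyshev_norm_sq]
    ring
  rw [h1, integral_cos_mul_sum (hfi _ _)]
  have h2 : ∫ t in (0 : ℝ)..Real.pi, f (Real.cos t) * ∑ k ∈ Finset.range n,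
      ((if k = 0 then 1 / Real.pi else 2 / Real.pi) * Real.cos (k * θ)) * Real.cos (k * t) =
      1 / Real.pi * ∫ t in (0 : ℝ)..Real.pi, f (Real.cos t) *
        (dirichletSum n (θ - t) + dirichletSum n (θ + t)) := by
    rw [← intervalIntegral.integral_const_mul]
    refine intervalIntegral.integral_congr fun t _ => ?_
    rw [mul_left_comm, ← sum_cos_mul_cos hn]
    congr 1
    exact Finset.sum_congr rfl fun k _ => by ring
  rw [h2, integral_mul_sub_add_eq (φ := fun t => f (Real.cos t)) hfi (fun t => by simp)
    (fun t => by simp) (continuous_dirichletSum n) (periodic_dirichletSum n)]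
  simp only [dirichletSum_neg]
  rw [intervalIntegral.integral_add]
  · exact (h.intervalIntegrable_comp_cos_sub θ _ _).mul_continuousOn
      (continuous_dirichletSum n).continuousOn
  · exact (h.intervalIntegrable_comp_cos_add θ _ _).mul_continuousOn
      (continuous_dirichletSum n).continuousOn

/-- The symmetric translates of `f ∘ cos` about a point `θ ∈ [0, π]`. -/
theorem HarmonicVarLE.comp_cos_sub {f : ℝ → ℝ} {C : ℝ} (h : HarmonicVarLE f (Icc (-1) 1) C)
    {θ : ℝ} (hθ : θ ∈ Icc 0 Real.pi) :
    HarmonicVarLE (fun u => f (Real.cos (θ - u))) (Ioc 0 Real.pi) (C + C + C) :=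
  h.comp_cos.comp_antitoneOn (g := fun u => θ - u) (fun s _ t _ hst => sub_le_sub_left hst _)
    fun u hu => ⟨by linarith [hu.2, hθ.1], by linarith [hu.1, hθ.2, hθ.1]⟩

theorem HarmonicVarLE.comp_cos_add {f : ℝ → ℝ} {C : ℝ} (h : HarmonicVarLE f (Icc (-1) 1) C)
    {θ : ℝ} (hθ : θ ∈ Icc 0 Real.pi) :
    HarmonicVarLE (fun u => f (Real.cos (θ + u))) (Ioc 0 Real.pi) (C + C + C) :=
  h.comp_cos.comp_monotoneOn (g := fun u => θ + u) (fun s _ t _ hst => add_le_add_right hst _)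
    fun u hu => ⟨by linarith [hu.1, hθ.1, Real.pi_pos], by linarith [hu.2, hθ.2]⟩

theorem HarmonicVarLE.abs_le {f : ℝ → ℝ} {C : ℝ} (h : HarmonicVarLE f (Icc (-1) 1) C) {t : ℝ}
    (ht : t ∈ Icc (-1 : ℝ) 1) : |f t| ≤ |f 1| + C := by
  have h1 := h.abs_sub_le ht (right_mem_Icc.2 (by norm_num))
  have h3 := abs_add_le (f t - f 1) (f 1)
  rw [sub_add_cancel] at h3
  linarith

/-- The partial sums of the Fourier–Chebyshev series of a function of bounded harmonic variation
are uniformly bounded. -/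
theorem HarmonicVarLE.exists_abs_chebyshevSection_le {f : ℝ → ℝ} {C : ℝ}
    (h : HarmonicVarLE f (Icc (-1) 1) C) :
    ∃ K, ∀ n N : ℕ, ∀ y ∈ Icc (-1 : ℝ) 1, |chebyshevSection f n N y| ≤ K := by
  have hpi := Real.pi_pos
  have hfi := h.intervalIntegrable_comp_cos
  -- The bound of `abs_integral_le` with `δ = π`, kernel constant `2 * π`, supremum `|f 1| + C` and
  -- variation `3 * C`, taken once for each of the two translates.
  set K := 1 / Real.pi * (2 * (2 * Real.pi * (5 * (|f 1| + C) + 3 * (C + C + C)))) with hK_def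
  have hC := h.nonneg
  have hK : 0 ≤ K := by positivity
  have h0 : ∀ N : ℕ, ∀ y ∈ Icc (-1 : ℝ) 1, |chebyshevSection f 0 N y| ≤ K := by
    intro N y hy
    rcases Nat.eq_zero_or_pos N with rfl | hN
    · simpa [chebyshevSection] using hK
    have hθ : Real.arccos y ∈ Icc 0 Real.pi := ⟨Real.arccos_nonneg y, Real.arccos_le_pi y⟩
    have hN' : (1 : ℝ) ≤ N := by exact_mod_cast hN
    rw [← Real.cos_arccos hy.1 hy.2, h.chebyshevSection_cos_eq hN, abs_mul,
      abs_of_pos (a := 1 / Real.pi) (by positivity)]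
    refine mul_le_mul_of_nonneg_left ?_ (by positivity)
    rw [two_mul (2 * Real.pi * _)]
    refine (abs_add_le _ _).trans (add_le_add ?_ ?_)
    · exact isHarmonicKernel_dirichletSum.abs_integral_le hN hpi le_rfl
        (by nlinarith [Real.two_le_pi]) (h.intervalIntegrable_comp_cos_sub _ _ _)
        (fun t _ => h.abs_le (Real.cos_mem_Icc _)) (h.comp_cos_sub hθ)
    · exact isHarmonicKernel_dirichletSum.abs_integral_le hN hpi le_rfl
        (by nlinarith [Real.two_le_pi]) (h.intervalIntegrable_comp_cos_add _ _ _)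
        (fun t _ => h.abs_le (Real.cos_mem_Icc _)) (h.comp_cos_add hθ)
  refine ⟨K + K, fun n N y hy => ?_⟩
  rcases le_total n N with hnN | hnN
  · have : chebyshevSection f n N y = chebyshevSection f 0 N y - chebyshevSection f 0 n y := by
      simp only [chebyshevSection, ← Finset.range_eq_Ico]
      rw [Finset.sum_Ico_eq_sub _ hnN]
    rw [this]
    exact (abs_sub _ _).trans (add_le_add (h0 N y hy) (h0 n y hy))
  · rw [chebyshevSection, Finset.Ico_eq_empty_of_le hnN]
    simpa using add_nonneg hK hK

/-! ### Convergence and termwise integration -/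

theorem arccos_mem_Ioo {x : ℝ} (hx : x ∈ Ioo (-1 : ℝ) 1) :
    Real.arccos x ∈ Ioo 0 Real.pi :=
  ⟨Real.arccos_pos.2 hx.2, lt_of_le_of_ne (Real.arccos_le_pi x) fun h =>
    absurd (Real.arccos_eq_pi.1 h) (not_le.2 hx.1)⟩

/-- The cosine decreases on `[0, π]`, so left and right are exchanged: the translate by `-u` sees
the right limit of `f` at `x`. -/
theorem tendsto_cos_arccos_sub {x : ℝ} (hx : x ∈ Ioo (-1 : ℝ) 1) :
    Tendsto (fun u => Real.cos (Real.arccos x - u)) (𝓝[>] 0) (𝓝[>] x) := by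
  have hθ := arccos_mem_Ioo hx
  refine tendsto_nhdsWithin_iff.2 ⟨?_, ?_⟩
  · have : Continuous fun u => Real.cos (Real.arccos x - u) := by fun_prop
    have := this.tendsto 0
    rw [sub_zero, Real.cos_arccos hx.1.le hx.2.le] at this
    exact this.mono_left nhdsWithin_le_nhds
  · filter_upwards [Ioo_mem_nhdsGT hθ.1] with u hu
    have := Real.strictAntiOn_cos (a := Real.arccos x - u) (b := Real.arccos x)
      ⟨by linarith [hu.2], by linarith [hu.1, hθ.2]⟩ ⟨hθ.1.le, hθ.2.le⟩ (by linarith [hu.1])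
    rwa [Real.cos_arccos hx.1.le hx.2.le] at this

theorem tendsto_cos_arccos_add {x : ℝ} (hx : x ∈ Ioo (-1 : ℝ) 1) :
    Tendsto (fun u => Real.cos (Real.arccos x + u)) (𝓝[>] 0) (𝓝[<] x) := by
  have hθ := arccos_mem_Ioo hx
  refine tendsto_nhdsWithin_iff.2 ⟨?_, ?_⟩
  · have : Continuous fun u => Real.cos (Real.arccos x + u) := by fun_prop
    have := this.tendsto 0
    rw [add_zero, Real.cos_arccos hx.1.le hx.2.le] at this
    exact this.mono_left nhdsWithin_le_nhds
  · filter_upwards [Ioo_mem_nhdsGT (sub_pos.2 hθ.2)] with u hu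
    have := Real.strictAntiOn_cos (a := Real.arccos x) (b := Real.arccos x + u)
      ⟨hθ.1.le, hθ.2.le⟩ ⟨by linarith [hu.1, hθ.1], by linarith [hu.2]⟩ (by linarith [hu.1])
    rwa [Real.cos_arccos hx.1.le hx.2.le] at this

theorem HarmonicVarLE.exists_one_sided_limits {f : ℝ → ℝ} {C : ℝ}
    (h : HarmonicVarLE f (Icc (-1) 1) C) {x : ℝ} (hx : x ∈ Ioo (-1 : ℝ) 1) :
    ∃ p m, Tendsto f (𝓝[>] x) (𝓝 p) ∧ Tendsto f (𝓝[<] x) (𝓝 m) := by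
  obtain ⟨p, hp⟩ := (h.mono (T := Ioc x 1)
    fun t ht => ⟨hx.1.le.trans ht.1.le, ht.2⟩).exists_tendsto_right hx.2
  obtain ⟨m, hm⟩ := (h.mono (T := Ico (-1) x)
    fun t ht => ⟨ht.1, ht.2.le.trans hx.2.le⟩).exists_tendsto_left hx.1
  exact ⟨p, m, hp, hm⟩

/-- **Waterman's theorem**: the Fourier–Chebyshev series of a function of bounded harmonic
variation converges on `(-1, 1)`. -/
theorem HarmonicVarLE.tendsto_chebyshevTail {f : ℝ → ℝ} {C : ℝ}
    (h : HarmonicVarLE f (Icc (-1) 1) C) (n : ℕ) {y : ℝ} (hy : y ∈ Ioo (-1 : ℝ) 1) :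
    Tendsto (fun N : ℕ => chebyshevSection f n N y) atTop (𝓝 (chebyshevTail f n y)) := by
  have hpi := Real.pi_pos
  have hfi := h.intervalIntegrable_comp_cos
  have hθ := Ioo_subset_Icc_self (arccos_mem_Ioo hy)
  obtain ⟨p, m, hp, hm⟩ := h.exists_one_sided_limits hy
  have hγ : Tendsto (fun n => ∫ t in (0 : ℝ)..Real.pi, dirichletSum n t) atTop
      (𝓝 (Real.pi / 2)) := by
    refine tendsto_const_nhds.congr' ?_
    filter_upwards [eventually_ge_atTop 1] with n hn
    exact (integral_dirichletSum hn).symm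
  have e1 := isHarmonicKernel_dirichletSum.tendsto_integral hγ
    (h.intervalIntegrable_comp_cos_sub _ _ _) (h.comp_cos_sub hθ) (hp.comp (tendsto_cos_arccos_sub hy))
  have e2 := isHarmonicKernel_dirichletSum.tendsto_integral hγ
    (h.intervalIntegrable_comp_cos_add _ _ _) (h.comp_cos_add hθ) (hm.comp (tendsto_cos_arccos_add hy))
  have e3 := ((e1.add e2).const_mul (1 / Real.pi)).sub_const (chebyshevSection f 0 n y)
  refine tendsto_nhds_limUnder ⟨_, e3.congr' ?_⟩
  filter_upwards [eventually_ge_atTop (max n 1)] with N hN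
  rw [← h.chebyshevSection_cos_eq ((le_max_right _ _).trans hN), Real.cos_arccos hy.1.le hy.2.le]
  simp only [chebyshevSection, ← Finset.range_eq_Ico]
  rw [Finset.sum_Ico_eq_sub _ ((le_max_left _ _).trans hN)]

theorem HarmonicVarLE.intervalIntegrable_mul_chebyshevWeight {f : ℝ → ℝ} {C : ℝ}
    (h : HarmonicVarLE f (Icc (-1) 1) C) (k : ℕ) :
    IntervalIntegrable (fun t => f t * (chebyshevP k).eval t * chebyshevWeight t) volume
      (-1) 1 := by
  have hw : IntervalIntegrable chebyshevWeight volume (-1) 1 := by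
    refine Polynomial.Chebyshev.intervalIntegrable_sqrt_one_sub_sq_inv.congr fun t ht => ?_
    rw [uIoc_of_le (by norm_num)] at ht
    exact (chebyshevWeight_eq (Ioc_subset_Icc_self ht)).symm
  have hPw : IntervalIntegrable (fun t => (chebyshevP k).eval t * chebyshevWeight t) volume
      (-1) 1 := hw.continuousOn_mul (by fun_prop)
  rw [intervalIntegrable_iff_integrableOn_Ioc_of_le (by norm_num)] at hPw ⊢
  have hf := h.intervalIntegrable (by norm_num)
  rw [intervalIntegrable_iff_integrableOn_Ioc_of_le (by norm_num)] at hf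
  simp_rw [mul_assoc]
  refine Integrable.bdd_mul (c := |f 1| + C) hPw hf.aestronglyMeasurable ?_
  filter_upwards [ae_restrict_mem measurableSet_Ioc] with t ht
  exact h.abs_le (Ioc_subset_Icc_self ht)

theorem continuous_chebyshevSection (f : ℝ → ℝ) (n N : ℕ) :
    Continuous (chebyshevSection f n N) := by
  unfold chebyshevSection; fun_prop

theorem mem_Ioo_of_mem_uIoc {x : ℝ} (hx : x ∈ Ioo (-1 : ℝ) 1) {t : ℝ} (ht : t ∈ uIoc (-1) x) :
    t ∈ Ioo (-1 : ℝ) 1 := by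
  rw [uIoc_of_le hx.1.le] at ht
  exact ⟨ht.1, ht.2.trans_lt hx.2⟩

theorem HarmonicVarLE.intervalIntegrable_chebyshevTail {f : ℝ → ℝ} {C : ℝ}
    (h : HarmonicVarLE f (Icc (-1) 1) C) (n : ℕ) {x : ℝ} (hx : x ∈ Ioo (-1 : ℝ) 1) :
    IntervalIntegrable (chebyshevTail f n) volume (-1) x := by
  obtain ⟨K, hK⟩ := h.exists_abs_chebyshevSection_le
  rw [intervalIntegrable_iff]
  have : IsFiniteMeasure (volume.restrict (uIoc (-1) x)) := by
    rw [uIoc_of_le hx.1.le]; infer_instance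
  refine Integrable.of_bound (C := K) ?_ ?_
  · refine aestronglyMeasurable_of_tendsto_ae atTop
      (fun N => (continuous_chebyshevSection f n N).aestronglyMeasurable) ?_
    filter_upwards [ae_restrict_mem measurableSet_uIoc] with t ht
    exact h.tendsto_chebyshevTail n (mem_Ioo_of_mem_uIoc hx ht)
  · filter_upwards [ae_restrict_mem measurableSet_uIoc] with t ht
    have ht' := mem_Ioo_of_mem_uIoc hx ht
    exact le_of_tendsto (h.tendsto_chebyshevTail n ht').abs
      (Eventually.of_forall fun N => hK n N t (Ioo_subset_Icc_self ht'))

/-- The Fourier–Chebyshev series of a function of bounded harmonic variation may be integrated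
term by term. -/
theorem HarmonicVarLE.tendsto_sum_integral_chebyshevTail {f : ℝ → ℝ} {C : ℝ}
    (h : HarmonicVarLE f (Icc (-1) 1) C) (n : ℕ) {x : ℝ} (hx : x ∈ Ioo (-1 : ℝ) 1) :
    Tendsto (fun N => ∑ k ∈ Finset.Ico n N,
      chebyshevCoeff f k * ∫ y in (-1 : ℝ)..x, (chebyshevP k).eval y) atTop
      (𝓝 (∫ y in (-1 : ℝ)..x, chebyshevTail f n y)) := by
  obtain ⟨K, hK⟩ := h.exists_abs_chebyshevSection_le
  have := intervalIntegral.tendsto_integral_filter_of_dominated_convergence (l := atTop)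
    (μ := volume) (a := -1) (b := x) (F := fun N => chebyshevSection f n N)
    (f := chebyshevTail f n) (fun _ => K)
    (Eventually.of_forall fun N => (continuous_chebyshevSection f n N).aestronglyMeasurable)
    (Eventually.of_forall fun N => Eventually.of_forall fun t ht =>
      hK n N t (Ioo_subset_Icc_self (mem_Ioo_of_mem_uIoc hx ht)))
    intervalIntegrable_const
    (Eventually.of_forall fun t ht => h.tendsto_chebyshevTail n (mem_Ioo_of_mem_uIoc hx ht))
  refine this.congr fun N => ?_
  simp only [chebyshevSection]
  rw [intervalIntegral.integral_finsetSum fun k _ =>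
    Continuous.intervalIntegrable (by fun_prop) _ _]
  exact Finset.sum_congr rfl fun k _ => intervalIntegral.integral_const_mul _ _

/-! ### Asymptotics of the integrated tails -/

theorem integral_chebyshevP {x : ℝ} (hx : x ∈ Ioo (-1 : ℝ) 1) (k : ℕ) :
    ∫ y in (-1 : ℝ)..x, (chebyshevP k).eval y =
      (if k = 0 then √(1 / Real.pi) else √(2 / Real.pi)) *
        ∫ θ in Real.arccos x..Real.pi, Real.cos (k * θ) * Real.sin θ := by
  have := intervalIntegral.integral_comp_mul_deriv (a := Real.pi) (b := Real.arccos x)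
    (f := Real.cos) (f' := fun θ => -Real.sin θ) (g := fun y => (chebyshevP k).eval y)
    (fun θ _ => Real.hasDerivAt_cos θ) (by fun_prop) (by fun_prop)
  rw [Real.cos_pi, Real.cos_arccos hx.1.le hx.2.le] at this
  rw [← this, intervalIntegral.integral_symm, ← intervalIntegral.integral_neg,
    ← intervalIntegral.integral_const_mul]
  refine intervalIntegral.integral_congr fun θ _ => ?_
  simp only [Function.comp_apply, chebyshevP_eval_cos]
  ring

/-- Keeping the factor `k ^ 2 - 1` on the left avoids a separate case `k = 1`. -/
theorem integral_cos_mul_sin_eq (k : ℕ) (θ : ℝ) :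
    ((k : ℝ) ^ 2 - 1) * ∫ t in θ..Real.pi, Real.cos (k * t) * Real.sin t =
      -Real.cos (k * Real.pi) - (k * (Real.sin (k * θ) * Real.sin θ) +
        Real.cos (k * θ) * Real.cos θ) := by
  rw [← intervalIntegral.integral_const_mul]
  rw [intervalIntegral.integral_eq_sub_of_hasDerivAt
    (f := fun t => k * (Real.sin (k * t) * Real.sin t) + Real.cos (k * t) * Real.cos t)
    (fun t _ => ?_) (Continuous.intervalIntegrable (by fun_prop) _ _)]
  · simp
  · have h1 := ((hasDerivAt_id t).const_mul (k : ℝ)).sin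
    have h2 := ((hasDerivAt_id t).const_mul (k : ℝ)).cos
    have := ((h1.mul (Real.hasDerivAt_sin t)).const_mul (k : ℝ)).add
      (h2.mul (Real.hasDerivAt_cos t))
    convert! this using 1
    simp only [id]
    ring

/-- Thus the integral is $-\sin(k\theta)\sin\theta/k+O(k^{-2})$, and only the leading term survives
in the limit. -/
theorem abs_integral_cos_mul_sin_add_le {θ : ℝ} (hθ : θ ∈ Icc 0 Real.pi) (k : ℕ) :
    |(k : ℝ) ^ 2 * (∫ t in θ..Real.pi, Real.cos (k * t) * Real.sin t) +
      k * (Real.sin (k * θ) * Real.sin θ)| ≤ 2 + Real.pi := by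
  have h1 := integral_cos_mul_sin_eq k θ
  have h2 : |∫ t in θ..Real.pi, Real.cos (k * t) * Real.sin t| ≤ Real.pi := by
    have := intervalIntegral.norm_integral_le_of_norm_le_const (a := θ) (b := Real.pi)
      (f := fun t => Real.cos (k * t) * Real.sin t) (C := 1) fun t _ => by
        rw [norm_mul]
        exact mul_le_one₀ (Real.abs_cos_le_one _) (abs_nonneg _) (Real.abs_sin_le_one _)
    rw [one_mul, abs_of_nonneg (sub_nonneg.2 hθ.2)] at this
    exact this.trans (by linarith [hθ.1])
  have h3 : |Real.cos (k * θ) * Real.cos θ| ≤ 1 := by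
    rw [abs_mul]
    exact mul_le_one₀ (Real.abs_cos_le_one _) (abs_nonneg _) (Real.abs_cos_le_one _)
  have h4 := Real.abs_cos_le_one (k * Real.pi)
  have h5 : (k : ℝ) ^ 2 * (∫ t in θ..Real.pi, Real.cos (k * t) * Real.sin t) +
      k * (Real.sin (k * θ) * Real.sin θ) =
      (∫ t in θ..Real.pi, Real.cos (k * t) * Real.sin t) - Real.cos (k * Real.pi) -
        Real.cos (k * θ) * Real.cos θ := by linarith
  rw [h5]
  rw [abs_le] at *
  constructor <;> linarith [h2.1, h2.2, h3.1, h3.2, h4.1, h4.2]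

/-- The arithmetic means of the differentiated sine-evaluated coefficients determine the jump. -/
theorem HarmonicVarLE.tendsto_mean_mul_sin {f : ℝ → ℝ} {C : ℝ}
    (h : HarmonicVarLE f (Icc (-1) 1) C) {x p m : ℝ} (hx : x ∈ Ioo (-1 : ℝ) 1)
    (hp : Tendsto f (𝓝[>] x) (𝓝 p)) (hm : Tendsto f (𝓝[<] x) (𝓝 m)) :
    Tendsto (fun n : ℕ => (n : ℝ)⁻¹ * ∑ k ∈ Finset.range n, (k * Real.sin (k * Real.arccos x)) *
      ∫ t in (0 : ℝ)..Real.pi, f (Real.cos t) * Real.cos (k * t)) atTop (𝓝 ((p - m) / 2)) := by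
  have hfi := h.intervalIntegrable_comp_cos
  have hθ := Ioo_subset_Icc_self (arccos_mem_Ioo hx)
  set θ := Real.arccos x with hθ_def
  have i1 : IntervalIntegrable (fun u => f (Real.cos (θ - u))) volume 0 Real.pi :=
    h.intervalIntegrable_comp_cos_sub θ _ _
  have i2 : IntervalIntegrable (fun u => f (Real.cos (θ + u))) volume 0 Real.pi :=
    h.intervalIntegrable_comp_cos_add θ _ _
  have e1 := isHarmonicKernel_sineSum.tendsto_integral tendsto_integral_sineSum i1
    (h.comp_cos_sub hθ) (hp.comp (tendsto_cos_arccos_sub hx))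
  have e2 := isHarmonicKernel_sineSum.tendsto_integral tendsto_integral_sineSum i2
    (h.comp_cos_add hθ) (hm.comp (tendsto_cos_arccos_add hx))
  -- The kernel is odd, so the two translates enter with opposite signs and the limit is a jump
  -- instead of a mean value.
  have e3 := (e1.sub e2).const_mul (1 / 2)
  rw [mul_one, mul_one, show 1 / 2 * (p - m) = (p - m) / 2 by ring] at e3
  refine e3.congr fun n => ?_
  rw [integral_cos_mul_sum (hfi _ _)]
  have h2 : ∫ t in (0 : ℝ)..Real.pi, f (Real.cos t) * ∑ k ∈ Finset.range n,
      (k * Real.sin (k * θ)) * Real.cos (k * t) =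
      1 / 2 * ∫ t in (0 : ℝ)..Real.pi, f (Real.cos t) * (sineSum n (θ - t) + sineSum n (θ + t)) := by
    rw [← intervalIntegral.integral_const_mul]
    refine intervalIntegral.integral_congr fun t _ => ?_
    rw [mul_left_comm, ← sum_mul_cos_mul_sin]
    congr 1
    exact Finset.sum_congr rfl fun k _ => by ring
  rw [h2, integral_mul_sub_add_eq (φ := fun t => f (Real.cos t)) hfi (fun t => by simp)
    (fun t => by simp) (continuous_sineSum n) (periodic_sineSum n),
    ← intervalIntegral.integral_sub
      (i1.mul_continuousOn (isHarmonicKernel_sineSum.continuous n).continuousOn)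
      (i2.mul_continuousOn (isHarmonicKernel_sineSum.continuous n).continuousOn), mul_left_comm,
    ← intervalIntegral.integral_const_mul (n : ℝ)⁻¹]
  congr 1
  refine intervalIntegral.integral_congr fun u _ => ?_
  simp only [sineSum_neg]
  ring

/-- The integrated terms times `k ^ 2` split into `c k` times a bounded factor, which tends to `0`
by Riemann–Lebesgue and hence in mean, and a leading part whose means are given by
`tendsto_mean_mul_sin`. -/
theorem HarmonicVarLE.tendsto_mul_integral_chebyshevTail {f : ℝ → ℝ} {C : ℝ}
    (h : HarmonicVarLE f (Icc (-1) 1) C) {x p m : ℝ} (hx : x ∈ Ioo (-1 : ℝ) 1)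
    (hp : Tendsto f (𝓝[>] x) (𝓝 p)) (hm : Tendsto f (𝓝[<] x) (𝓝 m)) :
    Tendsto (fun n : ℕ => (n : ℝ) * ∫ y in (-1 : ℝ)..x, chebyshevTail f n y) atTop
      (𝓝 (-(√(1 - x ^ 2) / Real.pi) * (p - m))) := by
  have hpi := Real.pi_pos
  have hfi := h.intervalIntegrable_comp_cos
  refine tendsto_mul_tail_of_cesaro (fun n => h.tendsto_sum_integral_chebyshevTail n hx) ?_
  set θ := Real.arccos x with hθ_def
  set c : ℕ → ℝ := fun k => ∫ t in (0 : ℝ)..Real.pi, f (Real.cos t) * Real.cos (k * t) with hc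
  set I : ℕ → ℝ := fun k => ∫ t in θ..Real.pi, Real.cos (k * t) * Real.sin t with hI
  have hc0 : Tendsto c atTop (𝓝 0) :=
    (tendsto_integral_mul_cos hpi.le (hfi _ _)).comp tendsto_natCast_atTop_atTop
  have hrem : Tendsto (fun k : ℕ => c k * ((k : ℝ) ^ 2 * I k + k * (Real.sin (k * θ) * Real.sin θ)))
      atTop (𝓝 0) := by
    have hb := hc0.abs.mul_const (2 + Real.pi)
    rw [abs_zero, zero_mul] at hb
    refine squeeze_zero_norm (fun k => ?_) hb
    rw [norm_mul]
    exact mul_le_mul_of_nonneg_left (abs_integral_cos_mul_sin_add_le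
      (Ioo_subset_Icc_self (arccos_mem_Ioo hx)) k) (abs_nonneg _)
  have hmain := ((hrem.cesaro).sub ((h.tendsto_mean_mul_sin hx hp hm).const_mul
    (Real.sin θ))).const_mul (2 / Real.pi)
  rw [← hθ_def, Real.sin_arccos,
    show 2 / Real.pi * (0 - √(1 - x ^ 2) * ((p - m) / 2)) =
      -(√(1 - x ^ 2) / Real.pi) * (p - m) by ring] at hmain
  refine hmain.congr fun n => ?_
  rw [← Real.sin_arccos, mul_left_comm (Real.sin _), ← mul_sub, mul_left_comm, Finset.mul_sum,
    ← Finset.sum_sub_distrib, Finset.mul_sum]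
  congr 1
  refine Finset.sum_congr rfl fun k _ => ?_
  rw [chebyshevCoeff_eq, integral_chebyshevP hx]
  -- The exceptional normalization at `k = 0` is harmless, since both sides carry a factor `k`.
  rcases Nat.eq_zero_or_pos k with rfl | hk
  · simp
  · have h1 := chebyshev_norm_sq k
    rw [if_neg hk.ne', if_neg hk.ne'] at h1
    rw [if_neg hk.ne']
    change 2 / Real.pi * (c k * ((k : ℝ) ^ 2 * I k + k * (Real.sin (k * θ) * Real.sin θ)) -
      Real.sin θ * (k * Real.sin (k * θ) * c k)) =
      (k : ℝ) ^ 2 * (√(2 / Real.pi) * c k * (√(2 / Real.pi) * I k))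
    linear_combination (-(c k * (k : ℝ) ^ 2 * I k)) * h1

theorem mainTheorem2 (f : ℝ → ℝ)
    (hf : (HBV (-1) 1 f ∧ (discontinuities f).Finite) ∨ WienerV 2 (-1) 1 f) :
    (∀ k : ℕ, IntervalIntegrable
      (fun t => f t * (chebyshevP k).eval t * chebyshevWeight t) volume (-1) 1) ∧
    (∀ n : ℕ, ∀ y ∈ Ioo (-1 : ℝ) 1,
      Tendsto (fun N : ℕ => chebyshevSection f n N y) atTop (𝓝 (chebyshevTail f n y))) ∧
    ∀ x ∈ Ioo (-1 : ℝ) 1,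
      (∀ n : ℕ, IntervalIntegrable (chebyshevTail f n) volume (-1) x) ∧
      ∃ fplus fminus : ℝ,
        Tendsto f (𝓝[>] x) (𝓝 fplus) ∧ Tendsto f (𝓝[<] x) (𝓝 fminus) ∧
        Tendsto (fun n : ℕ => (n : ℝ) * ∫ y in (-1 : ℝ)..x, chebyshevTail f n y) atTop
          (𝓝 (-(√(1 - x ^ 2) / Real.pi) * (fplus - fminus))) := by
  have hH : HBV (-1) 1 f := hf.elim (fun h => h.1) fun h => h.hbv
  obtain ⟨C, h⟩ := hH.harmonicVarLE
  refine ⟨h.intervalIntegrable_mul_chebyshevWeight, fun n y hy => h.tendsto_chebyshevTail n hy,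
    fun x hx => ⟨fun n => h.intervalIntegrable_chebyshevTail n hx, ?_⟩⟩
  obtain ⟨p, m, hp, hm⟩ := h.exists_one_sided_limits hx
  exact ⟨p, m, hp, hm, h.tendsto_mul_integral_chebyshevTail hx hp hm⟩
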